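/- There is an absolute constant $C>0$ such that the following holds. Let $G$ be a finite group and let $A\subset G$ be a non-empty set of size $|A|=\alpha|G|$ with distinct squares, i.e. $a^2\neq b^2$ for all distinct $a,b\in A$. Then the number of triples $(x,y,z)\in A^3$ with $xz=y^2$ is at least $\exp(-\exp(\alpha^{-C}))\,|G|^2$. -/

import Mathlib

namespace DistinctSquares

open Finset
open scoped Pointwise

/-! The proof is a density increment with a multiplicative gain. A cell is a two-sided translate `g
* U * h` of a dense set `U` that is almost invariant on both sides under `T ^ 24`, with `T` dense
and symmetric. If `A` has density `lam` on a cell, then either it has density `101/100 * lam` on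
another cell, whose parameters worsen from `ℓ` to `ℓ ^ 220`, or there are many solutions
(`HasDenseCell.step`). A density cannot exceed 1, so O(log(1/α)) steps suffice. The exponent `220 ^
n` is then a power of 1/α, and `ℓ ^ 220 ^ n` produces the double exponential.

For one step, suppose there is no increment. Then `A` has density at most 1.01·lam on every
translate of every smaller regular set, so by averaging it is close to equidistributed at smaller
scales. Hence most y in `A` inside the cell are such that `A` has density almost lam on both y·R and
R·y (`card_sparse_le`). By pigeonhole there is a dense set `Y` of such points, all near a single w
on both sides (`exists_cluster`).

Write x = w·c and z = d·w. The equation becomes c·d = w⁻¹y²w⁻¹ = (w⁻¹y)(yw⁻¹). The right side stays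
in a small neighbourhood of 1, and it takes |Y| distinct values because squares are distinct on `A`;
let `V` be this set of values. It remains to count pairs with c·d in `V`. By Croot–Sisask
almost-periodicity (`exists_almostPeriods`), convolution with the dense set `V` is almost invariant
under a smaller regular set `U`, so both factors may be smoothed over `U`. The smoothed functions
are nearly bounded by lam and have mean nearly lam, so they cannot avoid each other
(`le_sum_hitDensity`).

Regular sets come from `exists_regular`: almost-periodicity gives a dense `T` with a high power
inside (QQ⁻¹)², and a growth pigeonhole does the rest. -/

/-! ### Exponential tail bounds for independent samples -/

theorem sum_exp_le {ι : Type*} (Q : Finset ι) (Y : ι → ℝ) (hY : ∀ q ∈ Q, |Y q| ≤ 1)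
    (hmean : ∑ q ∈ Q, Y q = 0) (s : ℝ) (hs : |s| ≤ 1) :
    ∑ q ∈ Q, Real.exp (s * Y q) ≤ #Q * Real.exp (s ^ 2) := by
  have h1 : ∀ q ∈ Q, Real.exp (s * Y q) ≤ 1 + s * Y q + s ^ 2 := by
    intro q hq
    have hY1 := hY q hq
    have h2 : |s * Y q| ≤ 1 := by
      rw [abs_mul]
      exact mul_le_one₀ hs (abs_nonneg _) hY1
    have h3 := (abs_le.1 (Real.abs_exp_sub_one_sub_id_le h2)).2
    have h4 : (s * Y q) ^ 2 ≤ s ^ 2 := by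
      rw [mul_pow]
      have : (Y q) ^ 2 ≤ 1 := (sq_le_one_iff_abs_le_one _).2 hY1
      nlinarith [sq_nonneg s]
    linarith
  calc ∑ q ∈ Q, Real.exp (s * Y q) ≤ ∑ q ∈ Q, (1 + s * Y q + s ^ 2) := sum_le_sum h1
    _ = #Q * (1 + s ^ 2) := by
      simp only [sum_add_distrib, ← mul_sum, hmean, sum_const, nsmul_eq_mul]
      ring
    _ ≤ _ := by
      gcongr
      linarith [Real.add_one_le_exp (s ^ 2)]

/-- Chernoff's method: the moment generating function factors over coordinates, and s = ε/2
minimises the exponent k(s² - sε). -/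
theorem card_upper_tail_le {ι : Type*} [DecidableEq ι] (Q : Finset ι) (Y : ι → ℝ)
    (hY : ∀ q ∈ Q, |Y q| ≤ 1) (hmean : ∑ q ∈ Q, Y q = 0) (k : ℕ) (ε : ℝ) (hε : 0 < ε)
    (hε1 : ε ≤ 1) :
    (#{b ∈ Fintype.piFinset (fun _ : Fin k => Q) | ε * k < ∑ i, Y (b i)} : ℝ) ≤
      Real.exp (-(k * ε ^ 2 / 4)) * (#Q : ℝ) ^ k := by
  have hs : |ε / 2| ≤ 1 := by rw [abs_of_pos (by positivity)]; linarith
  have h1 : ∑ b ∈ Fintype.piFinset (fun _ : Fin k => Q), Real.exp (ε / 2 * ∑ i, Y (b i)) ≤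
      (#Q * Real.exp ((ε / 2) ^ 2)) ^ k := by
    simp only [mul_sum, Real.exp_sum]
    rw [← Finset.prod_univ_sum (fun _ : Fin k => Q) (fun _ q => Real.exp (ε / 2 * Y q))]
    rw [prod_const, card_univ, Fintype.card_fin]
    exact pow_le_pow_left₀ (sum_nonneg fun _ _ => (Real.exp_pos _).le)
      (sum_exp_le Q Y hY hmean _ hs) k
  have h2 : (#{b ∈ Fintype.piFinset (fun _ : Fin k => Q) | ε * k < ∑ i, Y (b i)} : ℝ) *
      Real.exp (ε / 2 * (ε * k)) ≤
      ∑ b ∈ Fintype.piFinset (fun _ : Fin k => Q), Real.exp (ε / 2 * ∑ i, Y (b i)) := by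
    calc _ = ∑ b ∈ Fintype.piFinset (fun _ : Fin k => Q) with ε * k < ∑ i, Y (b i),
          Real.exp (ε / 2 * (ε * k)) := by rw [sum_const, nsmul_eq_mul]
      _ ≤ ∑ b ∈ Fintype.piFinset (fun _ : Fin k => Q) with ε * k < ∑ i, Y (b i),
          Real.exp (ε / 2 * ∑ i, Y (b i)) := by
        refine sum_le_sum fun b hb => ?_
        have := (mem_filter.1 hb).2
        gcongr
      _ ≤ _ := sum_le_sum_of_subset_of_nonneg (filter_subset _ _)
        fun _ _ _ => (Real.exp_pos _).le
  have h3 := h2.trans h1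
  rw [← le_div_iff₀ (Real.exp_pos _)] at h3
  refine h3.trans_eq ?_
  rw [mul_pow, ← Real.exp_nat_mul, mul_div_assoc, ← Real.exp_sub, mul_comm]
  congr 2
  ring

theorem card_tail_le {ι : Type*} [DecidableEq ι] (Q : Finset ι) (Y : ι → ℝ)
    (hY : ∀ q ∈ Q, |Y q| ≤ 1) (hmean : ∑ q ∈ Q, Y q = 0) (k : ℕ) (ε : ℝ) (hε : 0 < ε)
    (hε1 : ε ≤ 1) :
    (#{b ∈ Fintype.piFinset (fun _ : Fin k => Q) | ε * k < |∑ i, Y (b i)|} : ℝ) ≤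
      2 * Real.exp (-(k * ε ^ 2 / 4)) * (#Q : ℝ) ^ k := by
  have h1 := card_upper_tail_le Q Y hY hmean k ε hε hε1
  have h2 := card_upper_tail_le Q (fun q => - Y q) (fun q hq => by rw [abs_neg]; exact hY q hq)
    (by rw [sum_neg_distrib, hmean, neg_zero]) k ε hε hε1
  have h3 : {b ∈ Fintype.piFinset (fun _ : Fin k => Q) | ε * k < |∑ i, Y (b i)|} ⊆
      {b ∈ Fintype.piFinset (fun _ : Fin k => Q) | ε * k < ∑ i, Y (b i)} ∪
      {b ∈ Fintype.piFinset (fun _ : Fin k => Q) | ε * k < ∑ i, -Y (b i)} := by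
    intro b hb
    simp only [mem_filter, mem_union, sum_neg_distrib] at hb ⊢
    rcases lt_abs.1 hb.2 with h | h
    · exact Or.inl ⟨hb.1, h⟩
    · exact Or.inr ⟨hb.1, h⟩
  have h4 := (card_le_card h3).trans (card_union_le _ _)
  have h5 : (#{b ∈ Fintype.piFinset (fun _ : Fin k => Q) | ε * k < |∑ i, Y (b i)|} : ℝ) ≤
      #{b ∈ Fintype.piFinset (fun _ : Fin k => Q) | ε * k < ∑ i, Y (b i)} +
      #{b ∈ Fintype.piFinset (fun _ : Fin k => Q) | ε * k < ∑ i, -Y (b i)} := by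
    exact_mod_cast h4
  linarith

/-! ### Sampling a convolution -/

section
variable {G : Type*} [Group G] [DecidableEq G]

/-- The proportion of `q ∈ Q` with `q⁻¹ * g ∈ D`, i.e. the convolution of the normalised
indicator of `Q` with the indicator of `D`. -/
noncomputable def hitDensity (Q D : Finset G) (g : G) : ℝ :=
  (#{q ∈ Q | q⁻¹ * g ∈ D} : ℝ) / #Q

theorem hitDensity_nonneg (Q D : Finset G) (g : G) : 0 ≤ hitDensity Q D g := by
  unfold hitDensity; positivity

theorem hitDensity_le_one (Q D : Finset G) (g : G) : hitDensity Q D g ≤ 1 := by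
  unfold hitDensity
  exact div_le_one_of_le₀ (by exact_mod_cast card_filter_le _ _) (by positivity)

/-- Random samples of `Q` approximate `hitDensity Q D` at a given point. -/
theorem card_bad_samples_le (Q D : Finset G) (hQ : Q.Nonempty) (k : ℕ) (ε : ℝ) (hε : 0 < ε)
    (hε1 : ε ≤ 1) (g : G) :
    (#{b ∈ Fintype.piFinset (fun _ : Fin k => Q) |
        ε * k < |(#{i | (b i)⁻¹ * g ∈ D} : ℝ) - k * hitDensity Q D g|} : ℝ) ≤
      2 * Real.exp (-(k * ε ^ 2 / 4)) * (#Q : ℝ) ^ k := by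
  have hQ0 : (#Q : ℝ) ≠ 0 := by exact_mod_cast hQ.card_pos.ne'
  have h := card_tail_le Q (fun q => (if q⁻¹ * g ∈ D then (1 : ℝ) else 0) - hitDensity Q D g)
    (fun q _ => by
      have h1 := hitDensity_nonneg Q D g
      have h2 := hitDensity_le_one Q D g
      rw [abs_le]; split_ifs <;> constructor <;> linarith)
    (by
      rw [sum_sub_distrib, sum_const, nsmul_eq_mul, sum_boole, hitDensity]
      field_simp
      ring) k ε hε hε1
  convert h using 6 with b
  simp [sum_sub_distrib, sum_boole]

end

/-! ### Almost periods and high powers inside (QQ⁻¹)² -/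

section
variable {G : Type*} [Group G] [Fintype G] [DecidableEq G]

/-- Croot–Sisask sampling. A random k-tuple from `Q`, translated by t, usually approximates F(t⁻¹·)
off a small set. Some fixed tuple b must serve many t in `P` at once, and if it serves both t and s
then F(t⁻¹·) and F(s⁻¹·) are close, so t⁻¹s is an almost period. -/
theorem exists_almostPeriods (P Q D : Finset G) (hP : P.Nonempty) (hQ : Q.Nonempty) (k : ℕ)
    (hk : 0 < k) (ε : ℝ) (hε : 0 < ε) (hε1 : ε ≤ 1) :
    ∃ T : Finset G, 1 ∈ T ∧ T⁻¹ = T ∧ T ⊆ P⁻¹ * P ∧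
      #P * #Q ^ k ≤ 2 * #T * Fintype.card G ^ k ∧
      ∀ τ ∈ T, (#{g | 2 * ε < |hitDensity Q D (τ * g) - hitDensity Q D g|} : ℝ) ≤
        8 * Real.exp (-(k * ε ^ 2 / 4)) * Fintype.card G := by
  classical
  set e := Real.exp (-(k * ε ^ 2 / 4)) with he
  set N := Fintype.card G with hN
  let F := hitDensity Q D
  let S : (Fin k → G) → G → ℝ := fun b g => (#{i | (b i)⁻¹ * g ∈ D} : ℝ)
  let bad : G → (Fin k → G) → Finset G := fun t b => {g | ε * k < |S b g - k * F (t⁻¹ * g)|}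
  have hQk : (0 : ℝ) < (#Q : ℝ) ^ k := by have := hQ.card_pos; positivity
  have hNpos : (0 : ℝ) < N := by
    have : 0 < Fintype.card G := Fintype.card_pos
    exact_mod_cast this
  have hepos : 0 < e := Real.exp_pos _
  -- translated samples
  let QK := Fintype.piFinset (fun _ : Fin k => Q)
  have hQKcard : (#QK : ℝ) = (#Q : ℝ) ^ k := by
    simp [QK, Fintype.card_piFinset]
  -- Markov: the mean size of the bad set is at most 2eN, so at least half of the samples have a bad
  -- set of size at most 4eN.
  have hgood : ∀ t : G, (#Q : ℝ) ^ k / 2 ≤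
      #{q ∈ QK | (#(bad t (fun i => t * q i)) : ℝ) ≤ 4 * e * N} := by
    intro t
    have h1 : ∑ q ∈ QK, (#(bad t (fun i => t * q i)) : ℝ) ≤ N * (2 * e * (#Q : ℝ) ^ k) := by
      have h2 : ∑ q ∈ QK, #(bad t (fun i => t * q i)) =
          ∑ g : G, #{q ∈ QK | g ∈ bad t (fun i => t * q i)} := by
        simp only [card_eq_sum_ones, sum_filter, bad]
        rw [sum_comm]
        refine sum_congr rfl fun g _ => sum_congr rfl fun q _ => ?_
        simp
      have h3 : ∀ g : G, (#{q ∈ QK | g ∈ bad t (fun i => t * q i)} : ℝ) ≤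
          2 * e * (#Q : ℝ) ^ k := by
        intro g
        have := card_bad_samples_le Q D hQ k ε hε hε1 (t⁻¹ * g)
        convert this using 6 with q
        simp [bad, S, F, mul_assoc]
      have h4 : (∑ q ∈ QK, (#(bad t (fun i => t * q i)) : ℝ)) =
          ∑ g : G, (#{q ∈ QK | g ∈ bad t (fun i => t * q i)} : ℝ) := by exact_mod_cast h2
      rw [h4]
      calc _ ≤ ∑ _g : G, 2 * e * (#Q : ℝ) ^ k := sum_le_sum fun g _ => h3 g
        _ = _ := by rw [sum_const, card_univ, nsmul_eq_mul]
    have h5 : (#{q ∈ QK | ¬ (#(bad t (fun i => t * q i)) : ℝ) ≤ 4 * e * N} : ℝ) * (4 * e * N) ≤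
        N * (2 * e * (#Q : ℝ) ^ k) := by
      refine le_trans ?_ h1
      calc _ = ∑ q ∈ QK with ¬ (#(bad t (fun i => t * q i)) : ℝ) ≤ 4 * e * N, 4 * e * N := by
            rw [sum_const, nsmul_eq_mul]
        _ ≤ ∑ q ∈ QK with ¬ (#(bad t (fun i => t * q i)) : ℝ) ≤ 4 * e * N,
            (#(bad t (fun i => t * q i)) : ℝ) :=
          sum_le_sum fun q hq => (not_le.1 (mem_filter.1 hq).2).le
        _ ≤ _ := sum_le_sum_of_subset_of_nonneg (filter_subset _ _) fun _ _ _ => by positivity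
    have h6 : (#{q ∈ QK | ¬ (#(bad t (fun i => t * q i)) : ℝ) ≤ 4 * e * N} : ℝ) ≤
        (#Q : ℝ) ^ k / 2 := by
      have h7 : 0 < 4 * e * N := by positivity
      rw [← le_div_iff₀ h7] at h5
      refine h5.trans_eq ?_
      field_simp
      norm_num
    have h8 := card_filter_add_card_filter_not (s := QK)
      (fun q => (#(bad t (fun i => t * q i)) : ℝ) ≤ 4 * e * N)
    have h9 : (#{q ∈ QK | (#(bad t (fun i => t * q i)) : ℝ) ≤ 4 * e * N} : ℝ) +
      #{q ∈ QK | ¬ (#(bad t (fun i => t * q i)) : ℝ) ≤ 4 * e * N} = #QK := by exact_mod_cast h8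
    rw [hQKcard] at h9
    linarith
  let E : (Fin k → G) → Finset G := fun b =>
    {t ∈ P | (fun i => t⁻¹ * b i) ∈ QK ∧ (#(bad t b) : ℝ) ≤ 4 * e * N}
  have hsum : (#P : ℝ) * ((#Q : ℝ) ^ k / 2) ≤ ∑ b : Fin k → G, (#(E b) : ℝ) := by
    have h1 : ∑ b : Fin k → G, #(E b) = ∑ t ∈ P, #{b : Fin k → G | (fun i => t⁻¹ * b i) ∈ QK ∧
        (#(bad t b) : ℝ) ≤ 4 * e * N} := by
      simp only [E, card_eq_sum_ones, sum_filter]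
      rw [sum_comm]
    have h2 : ∀ t ∈ P, (#Q : ℝ) ^ k / 2 ≤ #{b : Fin k → G | (fun i => t⁻¹ * b i) ∈ QK ∧
        (#(bad t b) : ℝ) ≤ 4 * e * N} := by
      intro t _
      refine (hgood t).trans ?_
      have : #{q ∈ QK | (#(bad t (fun i => t * q i)) : ℝ) ≤ 4 * e * N} ≤
          #{b : Fin k → G | (fun i => t⁻¹ * b i) ∈ QK ∧ (#(bad t b) : ℝ) ≤ 4 * e * N} := by
        refine card_le_card_of_injOn (fun q i => t * q i) ?_ ?_
        · intro q hq
          simp only [coe_filter, Set.mem_ofPred_eq, mem_univ, true_and, inv_mul_cancel_left] at hq ⊢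
          exact hq
        · intro q _ q' _ h
          funext i
          exact mul_left_cancel (congrFun h i)
      exact_mod_cast this
    have h3 : (∑ b : Fin k → G, (#(E b) : ℝ)) = ∑ t ∈ P, (#{b : Fin k → G |
        (fun i => t⁻¹ * b i) ∈ QK ∧ (#(bad t b) : ℝ) ≤ 4 * e * N} : ℝ) := by exact_mod_cast h1
    rw [h3]
    calc _ = ∑ _t ∈ P, (#Q : ℝ) ^ k / 2 := by rw [sum_const, nsmul_eq_mul]
      _ ≤ _ := sum_le_sum h2
  -- Pigeonhole over all N^k tuples.
  obtain ⟨b, -, hb⟩ : ∃ b ∈ (univ : Finset (Fin k → G)),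
      (#P : ℝ) * ((#Q : ℝ) ^ k / 2) / (N : ℝ) ^ k ≤ #(E b) := by
    refine exists_le_of_sum_le univ_nonempty ?_
    rw [sum_const, card_univ, nsmul_eq_mul, Fintype.card_fun, Fintype.card_fin]
    push_cast
    rw [mul_div_cancel₀ _ (by positivity)]
    exact hsum
  have hPpos : (0 : ℝ) < #P := by exact_mod_cast hP.card_pos
  have hEpos : (0 : ℝ) < #(E b) := lt_of_lt_of_le (by positivity) hb
  have hEne : (E b).Nonempty := card_pos.1 (by exact_mod_cast hEpos)
  refine ⟨(E b)⁻¹ * E b, ?_, ?_, ?_, ?_, ?_⟩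
  · obtain ⟨t, ht⟩ := hEne
    exact mem_mul.2 ⟨t⁻¹, inv_mem_inv ht, t, ht, inv_mul_cancel t⟩
  · rw [mul_inv_rev, inv_inv]
  · exact mul_subset_mul (inv_subset_inv (filter_subset _ _)) (filter_subset _ _)
  · have h1 : #(E b) ≤ #((E b)⁻¹ * E b) := card_le_card_mul_left (hEne.inv)
    have h2 : (#P : ℝ) * (#Q : ℝ) ^ k ≤ 2 * #(E b) * (N : ℝ) ^ k := by
      rw [div_le_iff₀ (by positivity)] at hb
      linarith
    have h3 : #P * #Q ^ k ≤ 2 * #(E b) * N ^ k := by exact_mod_cast h2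
    refine h3.trans ?_
    gcongr
  · intro τ hτ
    obtain ⟨t', ht', s, hs, rfl⟩ := mem_mul.1 hτ
    obtain ⟨t, ht, rfl⟩ := mem_inv.1 ht'
    have htb := (mem_filter.1 ht).2.2
    have hsb := (mem_filter.1 hs).2.2
    -- At the point s*g, the tuple b estimates both F(t⁻¹sg) and F(g), unless s*g is bad for t or
    -- for s.
    have h1 : #{g | 2 * ε < |hitDensity Q D (t⁻¹ * s * g) - hitDensity Q D g|} ≤
        #(bad t b ∪ bad s b) := by
      refine card_le_card_of_injOn (fun g => s * g) ?_ ?_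
      · intro g hg
        simp only [coe_filter, Set.mem_ofPred_eq, mem_univ, true_and] at hg
        simp only [coe_union, Set.mem_union, mem_coe, bad, mem_filter, mem_univ, true_and]
        by_contra hcon
        push Not at hcon
        obtain ⟨h2, h3⟩ := hcon
        rw [inv_mul_cancel_left] at h3
        rw [← mul_assoc] at h2
        have hk' : (0 : ℝ) < k := by exact_mod_cast hk
        have h4 : |k * F (t⁻¹ * s * g) - k * F g| ≤ 2 * ε * k := by
          have := abs_sub_le (k * F (t⁻¹ * s * g)) (S b (s * g)) (k * F g)
          rw [abs_sub_comm] at h2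
          linarith
        rw [← mul_sub, abs_mul, abs_of_pos hk'] at h4
        have h5 : |F (t⁻¹ * s * g) - F g| ≤ 2 * ε := by
          by_contra h6
          push Not at h6
          nlinarith
        exact absurd hg (not_lt.2 h5)
      · intro g _ g' _ h
        exact mul_left_cancel h
    have h2 : (#{g | 2 * ε < |hitDensity Q D (t⁻¹ * s * g) - hitDensity Q D g|} : ℝ) ≤
        #(bad t b) + #(bad s b) := by exact_mod_cast h1.trans (card_union_le _ _)
    linarith

/-- Triangle inequality along a product; exceptional sets keep their size under translation, so both
errors grow linearly in m. -/
theorem almostPeriods_pow (F : G → ℝ) (T : Finset G) (δ B : ℝ)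
    (hT : ∀ τ ∈ T, (#{g | δ < |F (τ * g) - F g|} : ℝ) ≤ B) (m : ℕ) :
    ∀ τ ∈ T ^ m, (#{g | m * δ < |F (τ * g) - F g|} : ℝ) ≤ m * B := by
  induction m with
  | zero =>
    intro τ hτ
    rw [pow_zero, mem_one] at hτ
    subst hτ
    simp
  | succ m ih =>
    intro τ hτ
    rw [pow_succ] at hτ
    obtain ⟨a, ha, b, hb, rfl⟩ := mem_mul.1 hτ
    have h1 := ih a ha
    have h2 := hT b hb
    have h3 : ({g | ((m + 1 : ℕ) : ℝ) * δ < |F (a * b * g) - F g|} : Finset G) ⊆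
        ({g | m * δ < |F (a * (b * g)) - F (b * g)|} : Finset G) ∪
          ({g | δ < |F (b * g) - F g|} : Finset G) := by
      intro g hg
      simp only [mem_filter, mem_univ, true_and, mem_union] at hg ⊢
      by_contra hcon
      push Not at hcon
      have := abs_sub_le (F (a * b * g)) (F (b * g)) (F g)
      rw [← mul_assoc] at hcon
      push_cast at hg
      linarith [hcon.1, hcon.2]
    have h4 : #({g | m * δ < |F (a * (b * g)) - F (b * g)|} : Finset G) ≤
        #({g | m * δ < |F (a * g) - F g|} : Finset G) := by
      refine card_le_card_of_injOn (fun g => b * g) (fun g hg => ?_)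
        fun g _ g' _ h => mul_left_cancel h
      simpa using hg
    have h5 : (#{g | ((m + 1 : ℕ) : ℝ) * δ < |F (a * b * g) - F g|} : ℝ) ≤
        #({g | m * δ < |F (a * g) - F g|} : Finset G) + #({g | δ < |F (b * g) - F g|} : Finset G) := by
      exact_mod_cast (card_le_card h3).trans ((card_union_le _ _).trans (by gcongr))
    push_cast at h5 ⊢
    linarith

theorem le_exp_of_hundred_le (x : ℝ) (hx : 100 ≤ x) : 384 * x ^ 2 < Real.exp x := by
  have h := Real.pow_div_factorial_le_exp x (by linarith) 4
  norm_num [Nat.factorial] at h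
  refine lt_of_lt_of_le ?_ h
  nlinarith [sq_nonneg x, mul_pos (show (0 : ℝ) < x ^ 2 by positivity)
    (show (0 : ℝ) < x ^ 2 - 9216 by nlinarith)]

theorem exp_neg_le_half_mul (y z : ℝ) (h : y + 1 ≤ z) :
    Real.exp (-z) ≤ Real.exp (-y) / 2 := by
  have h1 : Real.exp (-z) ≤ Real.exp (-y) * Real.exp (-1) := by
    rw [← Real.exp_add]
    exact Real.exp_le_exp.2 (by linarith)
  have h2 : Real.exp (-1) ≤ 1 / 2 := by
    rw [Real.exp_neg]
    rw [inv_le_comm₀ (Real.exp_pos _) (by norm_num)]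
    linarith [Real.add_one_le_exp (1 : ℝ)]
  nlinarith [Real.exp_pos (-y)]

/-- A dense set whose high power lies in a bounded power of `Q`. -/
theorem exists_pow_subset (Q : Finset G) (ℓ : ℕ) (hℓ : 100 ≤ ℓ)
    (hQ : Real.exp (-ℓ) * Fintype.card G ≤ #Q) :
    ∃ T : Finset G, 1 ∈ T ∧ T⁻¹ = T ∧ Real.exp (-(ℓ : ℝ) ^ 10) * Fintype.card G ≤ #T ∧
      T ^ (48 * ℓ ^ 2) ⊆ (Q * Q⁻¹) ^ 2 := by
  have hN : (0 : ℝ) < Fintype.card G := by exact_mod_cast (Fintype.card_pos : 0 < Fintype.card G)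
  have hQpos : (0 : ℝ) < #Q := lt_of_lt_of_le (by positivity) hQ
  have hQne : Q.Nonempty := card_pos.1 (by exact_mod_cast hQpos)
  have hℓ' : (100 : ℝ) ≤ ℓ := by exact_mod_cast hℓ
  set M : ℕ := 48 * ℓ ^ 2 with hM
  have hMR : (M : ℝ) = 48 * (ℓ : ℝ) ^ 2 := by rw [hM]; push_cast; ring
  have hM1 : (1 : ℝ) ≤ M := by rw [hMR]; nlinarith
  -- With ε = 1/(8M) the tail exponent is 2ℓ. An M-fold product then moves the convolution by at
  -- most 2εM = 1/4 off a set of size 8M·exp(-2ℓ)|G|, which is less than exp(-ℓ)|G| and so less than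
  -- |Q|.
  set k : ℕ := 512 * M ^ 2 * ℓ with hk
  have hkR : (k : ℝ) = 512 * (M : ℝ) ^ 2 * ℓ := by rw [hk]; push_cast; ring
  have hk0 : 0 < k := by
    have : (0 : ℝ) < k := by rw [hkR]; positivity
    exact_mod_cast this
  have hε1 : 1 / (8 * (M : ℝ)) ≤ 1 := by
    rw [div_le_one (by positivity)]; linarith
  obtain ⟨T, h1, hinv, -, hcard, hap⟩ := exists_almostPeriods Q Q (Q⁻¹ * Q) hQne hQne k hk0
    (1 / (8 * (M : ℝ))) (by positivity) hε1
  have hexp : (k : ℝ) * (1 / (8 * (M : ℝ))) ^ 2 / 4 = 2 * ℓ := by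
    rw [hkR]; field_simp; norm_num
  rw [hexp] at hap
  refine ⟨T, h1, hinv, ?_, ?_⟩
  · have h2 : (#Q : ℝ) ^ (k + 1) ≤ 2 * #T * (Fintype.card G : ℝ) ^ k := by
      rw [pow_succ']; exact_mod_cast hcard
    have h3 : (Real.exp (-ℓ) * Fintype.card G) ^ (k + 1) ≤ (#Q : ℝ) ^ (k + 1) := by
      gcongr
    have h4 : Real.exp (-ℓ) ^ (k + 1) * Fintype.card G ≤ 2 * #T := by
      have h5 := h3.trans h2
      rw [mul_pow, pow_succ (Fintype.card G : ℝ) k] at h5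
      have h6 : (0 : ℝ) < (Fintype.card G : ℝ) ^ k := by positivity
      refine le_of_mul_le_mul_right ?_ h6
      linarith
    have h7 : Real.exp (-(ℓ : ℝ) ^ 10) ≤ Real.exp (-((k + 1) * ℓ)) / 2 := by
      refine exp_neg_le_half_mul _ _ ?_
      rw [hkR, hMR]
      have h8 : (10 : ℝ) ^ 8 ≤ (ℓ : ℝ) ^ 4 := by
        calc (10 : ℝ) ^ 8 = 100 ^ 4 := by norm_num
          _ ≤ _ := by gcongr
      have h9 : (10 : ℝ) ^ 8 * (ℓ : ℝ) ^ 6 ≤ (ℓ : ℝ) ^ 10 := by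
        calc _ ≤ (ℓ : ℝ) ^ 4 * (ℓ : ℝ) ^ 6 := by gcongr
          _ = _ := by ring
      have h10 : (ℓ : ℝ) ≤ (ℓ : ℝ) ^ 6 := le_self_pow₀ (by linarith) (by norm_num)
      have h11 : (1 : ℝ) ≤ (ℓ : ℝ) ^ 6 := one_le_pow₀ (by linarith)
      nlinarith
    have h8 : Real.exp (-ℓ) ^ (k + 1) = Real.exp (-((k + 1) * ℓ)) := by
      rw [← Real.exp_nat_mul]; congr 1; push_cast; ring
    rw [h8] at h4
    nlinarith
  · have hpow := almostPeriods_pow (hitDensity Q (Q⁻¹ * Q)) T _ _ hap M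
    intro τ hτ
    have h2 := hpow τ hτ
    have h3 : (#{g | (M : ℝ) * (2 * (1 / (8 * (M : ℝ)))) < |hitDensity Q (Q⁻¹ * Q) (τ * g) -
        hitDensity Q (Q⁻¹ * Q) g|} : ℝ) < #Q := by
      refine lt_of_le_of_lt h2 (lt_of_lt_of_le ?_ hQ)
      have h4 := le_exp_of_hundred_le ℓ hℓ'
      have h5 : Real.exp (-ℓ) = Real.exp (-(2 * (ℓ : ℝ))) * Real.exp ℓ := by
        rw [← Real.exp_add]; congr 1; ring
      rw [h5]
      calc (M : ℝ) * (8 * Real.exp (-(2 * (ℓ : ℝ))) * Fintype.card G)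
          = (Real.exp (-(2 * (ℓ : ℝ))) * Fintype.card G) * (384 * (ℓ : ℝ) ^ 2) := by
            rw [hMR]; ring
        _ < (Real.exp (-(2 * (ℓ : ℝ))) * Fintype.card G) * Real.exp ℓ := by gcongr
        _ = _ := by ring
    have h4 : (M : ℝ) * (2 * (1 / (8 * (M : ℝ)))) = 1 / 4 := by field_simp; norm_num
    rw [h4] at h3
    obtain ⟨g, hgQ, hg⟩ := exists_mem_notMem_of_card_lt_card (by exact_mod_cast h3 :
      #{g | (1 / 4 : ℝ) < |hitDensity Q (Q⁻¹ * Q) (τ * g) - hitDensity Q (Q⁻¹ * Q) g|} < #Q)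
    simp only [mem_filter, mem_univ, true_and, not_lt] at hg
    -- The convolution equals 1 on all of `Q`, so it is still positive at τ*g. Thus τ*g lies in
    -- QQ⁻¹Q, and τ in (QQ⁻¹)².
    have h5 : hitDensity Q (Q⁻¹ * Q) g = 1 := by
      rw [hitDensity, filter_true_of_mem fun q hq => mul_mem_mul (inv_mem_inv hq) hgQ,
        div_self hQpos.ne']
    have h6 : 0 < hitDensity Q (Q⁻¹ * Q) (τ * g) := by
      rw [h5] at hg
      linarith [(abs_le.1 hg).1]
    have h7 : ({q ∈ Q | q⁻¹ * (τ * g) ∈ Q⁻¹ * Q} : Finset G).Nonempty := by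
      rw [nonempty_iff_ne_empty]
      intro h
      rw [hitDensity, h] at h6
      simp at h6
    obtain ⟨q, hq⟩ := h7
    obtain ⟨hqQ, hq'⟩ := mem_filter.1 hq
    obtain ⟨a, ha, b, hb, hab⟩ := mem_mul.1 hq'
    rw [pow_two]
    have h8 : τ = (q * a) * (b * g⁻¹) := by
      have : q * (a * b) * g⁻¹ = τ := by rw [hab]; group
      rw [← this]; group
    rw [h8]
    exact mul_mem_mul (mul_mem_mul hqQ ha) (mul_mem_mul hb (inv_mem_inv hgQ))

/-! ### Regular sets by pigeonholing growth -/

theorem exp_le_one_add_inv_pow (ℓ : ℕ) (hℓ : 1 ≤ ℓ) :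
    Real.exp ℓ ≤ (1 + 1 / (ℓ : ℝ)) ^ (2 * ℓ ^ 2) := by
  have hℓ' : (1 : ℝ) ≤ ℓ := by exact_mod_cast hℓ
  have h1 : Real.exp (1 / (2 * (ℓ : ℝ))) ≤ 1 + 1 / (ℓ : ℝ) := by
    have h2 : |1 / (2 * (ℓ : ℝ))| ≤ 1 := by
      rw [abs_of_pos (by positivity), div_le_one (by positivity)]; linarith
    have h3 := (abs_le.1 (Real.abs_exp_sub_one_sub_id_le h2)).2
    have h4 : (1 / (2 * (ℓ : ℝ))) ^ 2 ≤ 1 / (2 * (ℓ : ℝ)) := by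
      rw [sq]
      exact mul_le_of_le_one_right (by positivity) (abs_le.1 h2).2
    have h5 : 1 / (ℓ : ℝ) = 1 / (2 * (ℓ : ℝ)) + 1 / (2 * (ℓ : ℝ)) := by field_simp; norm_num
    linarith
  calc Real.exp ℓ = Real.exp (1 / (2 * (ℓ : ℝ))) ^ (2 * ℓ ^ 2) := by
        rw [← Real.exp_nat_mul]; congr 1; push_cast; field_simp
    _ ≤ _ := by gcongr

/-- A symmetric set close to `Q * Q⁻¹` which is almost invariant, on both sides, under a dense
symmetric set. -/
theorem exists_regular (Q : Finset G) (ℓ : ℕ) (hℓ : 100 ≤ ℓ)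
    (hQ : Real.exp (-ℓ) * Fintype.card G ≤ #Q) :
    ∃ U T : Finset G, 1 ∈ T ∧ T⁻¹ = T ∧ U⁻¹ = U ∧ U ⊆ (Q * Q⁻¹) ^ 5 ∧ T ^ 24 ⊆ (Q * Q⁻¹) ^ 2 ∧
      Real.exp (-ℓ) * Fintype.card G ≤ #U ∧ Real.exp (-(ℓ : ℝ) ^ 10) * Fintype.card G ≤ #T ∧
      (#(T ^ 24 * U * T ^ 24) : ℝ) ≤ (1 + 1 / (ℓ : ℝ)) * #U := by
  obtain ⟨T, h1, hinv, hT, hpow⟩ := exists_pow_subset Q ℓ hℓ hQ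
  have hN : (0 : ℝ) < Fintype.card G := by exact_mod_cast (Fintype.card_pos : 0 < Fintype.card G)
  have hQpos : (0 : ℝ) < #Q := lt_of_lt_of_le (by positivity) hQ
  have hQne : Q.Nonempty := card_pos.1 (by exact_mod_cast hQpos)
  have hℓ' : (100 : ℝ) ≤ ℓ := by exact_mod_cast hℓ
  let W : ℕ → Finset G := fun j => T ^ (24 * j) * (Q * Q⁻¹) * T ^ (24 * j)
  have hW0 : (#Q : ℝ) ≤ #(W 0) := by
    simp only [W, mul_zero, pow_zero, one_mul, mul_one]
    exact_mod_cast card_le_card_mul_right hQne.inv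
  have hWs : ∀ j, T ^ 24 * W j * T ^ 24 = W (j + 1) := by
    intro j
    simp only [W]
    rw [show T ^ (24 * (j + 1)) = T ^ 24 * T ^ (24 * j) by rw [← pow_add]; congr 1; ring]
    simp only [mul_assoc]
    rw [(Commute.pow_pow_self T 24 (24 * j)).eq]
  -- If each of the 2ℓ² steps grew by more than 1 + 1/ℓ, the last set would have more than
  -- exp(ℓ)·exp(-ℓ)|G| = |G| elements. The bound on j also keeps T^(24j) inside (QQ⁻¹)².
  obtain ⟨j, hj, hjW⟩ : ∃ j < 2 * ℓ ^ 2, (#(W (j + 1)) : ℝ) ≤ (1 + 1 / (ℓ : ℝ)) * #(W j) := by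
    by_contra hcon
    push Not at hcon
    have h2 : ∀ j ≤ 2 * ℓ ^ 2, (1 + 1 / (ℓ : ℝ)) ^ j * #(W 0) ≤ #(W j) := by
      intro j
      induction j with
      | zero => intro _; simp
      | succ j ih =>
        intro hj
        have h3 := ih (by omega)
        have h4 := hcon j (by omega)
        calc _ = (1 + 1 / (ℓ : ℝ)) * ((1 + 1 / (ℓ : ℝ)) ^ j * #(W 0)) := by ring
          _ ≤ (1 + 1 / (ℓ : ℝ)) * #(W j) := by gcongr
          _ ≤ _ := h4.le
    have h5 : (Fintype.card G : ℝ) ≤ (1 + 1 / (ℓ : ℝ)) ^ (2 * ℓ ^ 2 - 1) * #(W 0) * (1 + 1 / (ℓ : ℝ)) := by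
      have h6 := exp_le_one_add_inv_pow ℓ (by omega)
      have h7 : (1 + 1 / (ℓ : ℝ)) ^ (2 * ℓ ^ 2) =
          (1 + 1 / (ℓ : ℝ)) ^ (2 * ℓ ^ 2 - 1) * (1 + 1 / (ℓ : ℝ)) := by
        rw [← pow_succ]; congr 1
        have : 1 ≤ ℓ ^ 2 := Nat.one_le_pow _ _ (by omega)
        omega
      calc (Fintype.card G : ℝ) = Real.exp ℓ * (Real.exp (-ℓ) * Fintype.card G) := by
            rw [← mul_assoc, ← Real.exp_add]; simp
        _ ≤ (1 + 1 / (ℓ : ℝ)) ^ (2 * ℓ ^ 2) * #(W 0) := by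
            gcongr
            exact hQ.trans hW0
        _ = _ := by rw [h7]; ring
    have h1ℓ : 1 ≤ 2 * ℓ ^ 2 := by
      have : 1 ≤ ℓ ^ 2 := Nat.one_le_pow _ _ (by omega)
      omega
    have h8 := h2 (2 * ℓ ^ 2 - 1) (by omega)
    have h9 := hcon (2 * ℓ ^ 2 - 1) (by omega)
    have h10 : (#(W (2 * ℓ ^ 2 - 1 + 1)) : ℝ) ≤ Fintype.card G := by
      exact_mod_cast card_le_univ _
    have h11 : (1 + 1 / (ℓ : ℝ)) ^ (2 * ℓ ^ 2 - 1) * #(W 0) * (1 + 1 / (ℓ : ℝ)) ≤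
        (1 + 1 / (ℓ : ℝ)) * #(W (2 * ℓ ^ 2 - 1)) := by
      rw [mul_comm]
      gcongr
    linarith
  have hTsub : ∀ i, i ≤ 48 * ℓ ^ 2 → T ^ i ⊆ (Q * Q⁻¹) ^ 2 := fun i hi =>
    (pow_subset_pow_right h1 hi).trans hpow
  refine ⟨W j, T, h1, hinv, ?_, ?_, ?_, ?_, hT, ?_⟩
  · simp only [W, mul_inv_rev, inv_inv, mul_assoc]
    rw [← inv_pow, hinv]
  · calc W j ⊆ (Q * Q⁻¹) ^ 2 * (Q * Q⁻¹) * (Q * Q⁻¹) ^ 2 :=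
          mul_subset_mul (mul_subset_mul (hTsub _ (by omega)) subset_rfl) (hTsub _ (by omega))
      _ = _ := by rw [← pow_succ, ← pow_add]
  · refine hTsub 24 ?_
    have : 1 ≤ ℓ ^ 2 := Nat.one_le_pow _ _ (by omega)
    omega
  · refine hQ.trans (hW0.trans ?_)
    have : #(W 0) ≤ #(W j) := by
      refine card_le_card ?_
      simp only [W, mul_zero, pow_zero, one_mul, mul_one]
      intro x hx
      have h1' : (1 : G) ∈ T ^ (24 * j) := one_mem_pow h1
      have := mul_mem_mul (mul_mem_mul h1' hx) h1'
      simpa using this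
    exact_mod_cast this
  · rw [hWs]; exact hjW

theorem card_le_add_of_subset_image_union {ι : Type*} [DecidableEq ι] {S A B : Finset ι} {f : ι → ι}
    (h : S ⊆ A.image f ∪ B) : #S ≤ #A + #B :=
  (card_le_card h).trans ((card_union_le _ _).trans (Nat.add_le_add_right card_image_le _))

end

/-! ### Few points of a dense cell see a sparse neighbourhood -/

section
variable {G : Type*} [Group G] [DecidableEq G]

theorem card_filter_inv {R : Finset G} (hR : R⁻¹ = R) (p : G → Prop) [DecidablePred p] :
    #{r ∈ R | p r⁻¹} = #{r ∈ R | p r} := by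
  refine card_bij' (fun r _ => r⁻¹) (fun r _ => r⁻¹) ?_ ?_ (by simp) (by simp)
  · intro r hr
    obtain ⟨h1, h2⟩ := mem_filter.1 hr
    exact mem_filter.2 ⟨by rw [← hR]; exact inv_mem_inv h1, h2⟩
  · intro r hr
    obtain ⟨h1, h2⟩ := mem_filter.1 hr
    exact mem_filter.2 ⟨by rw [← hR]; exact inv_mem_inv h1, by rwa [inv_inv]⟩

theorem conj_mem_pow {S T : Finset G} {k : ℕ} (g : G) (h : ∀ x ∈ S, g⁻¹ * x * g ∈ T ^ k) (n : ℕ) :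
    ∀ x ∈ S ^ n, g⁻¹ * x * g ∈ T ^ (k * n) := by
  induction n with
  | zero =>
    intro x hx
    rw [pow_zero, mem_one] at hx
    subst hx
    simp
  | succ n ih =>
    intro x hx
    rw [pow_succ] at hx
    obtain ⟨a, ha, b, hb, rfl⟩ := mem_mul.1 hx
    have := mul_mem_mul (ih a ha) (h b hb)
    rw [← pow_add, ← Nat.mul_succ] at this
    convert this using 1
    group

/-- If few `y ∈ C` leave `C`, most elements of a subset of density `lam` stay after translation. -/
theorem card_translate_ge (A C : Finset G) (lam eps : ℝ) (r : G)
    (hd : lam * #C ≤ #{y ∈ C | y ∈ A}) (hC : (#{y ∈ C | y * r⁻¹ ∉ C} : ℝ) ≤ eps * #C) :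
    (lam - eps) * #C ≤ #{w ∈ C | w * r ∈ A} := by
  have h1 : #{y ∈ C | y ∈ A} ≤ #{w ∈ C | w * r ∈ A} + #{y ∈ C | y * r⁻¹ ∉ C} := by
    have h2 : {y ∈ C | y ∈ A} ⊆
        ({w ∈ C | w * r ∈ A} : Finset G).image (· * r) ∪ {y ∈ C | y * r⁻¹ ∉ C} := by
      intro y hy
      obtain ⟨hyC, hyA⟩ := mem_filter.1 hy
      by_cases h : y * r⁻¹ ∈ C
      · refine mem_union_left _ (mem_image.2 ⟨y * r⁻¹, mem_filter.2 ⟨h, ?_⟩, ?_⟩) <;> simp [hyA]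
      · exact mem_union_right _ (mem_filter.2 ⟨hyC, h⟩)
    exact card_le_add_of_subset_image_union h2
  have h3 : (#{y ∈ C | y ∈ A} : ℝ) ≤ #{w ∈ C | w * r ∈ A} + #{y ∈ C | y * r⁻¹ ∉ C} := by
    exact_mod_cast h1
  linarith

theorem sum_card_filter_comm {ι κ : Type*} (s : Finset ι) (t : Finset κ) (p : ι → κ → Prop)
    [∀ i j, Decidable (p i j)] :
    (∑ i ∈ s, (#{j ∈ t | p i j} : ℝ)) = ∑ j ∈ t, (#{i ∈ s | p i j} : ℝ) := by
  have : ∑ i ∈ s, #{j ∈ t | p i j} = ∑ j ∈ t, #{i ∈ s | p i j} := by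
    simp only [card_eq_sum_ones, sum_filter]
    rw [sum_comm]
  exact_mod_cast this

/-- In the absence of density increments, few `y ∈ A ∩ C` are such that `A` is sparse on `y * R`. -/
theorem card_sparse_le (A C R R₂ : Finset G) (lam eps : ℝ) (hlam : 0 < lam)
    (heps : eps ≤ lam / 1000) (hRne : R.Nonempty) (hR₂ne : R₂.Nonempty)
    (hC : ∀ r ∈ R, (#{y ∈ C | y * r⁻¹ ∉ C} : ℝ) ≤ eps * #C)
    (hC₂ : ∀ r ∈ R₂, (#{y ∈ C | y * r⁻¹ ∉ C} : ℝ) ≤ eps * #C)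
    (hR : ∀ r ∈ R₂, (#{s ∈ R | r⁻¹ * s ∉ R} : ℝ) ≤ eps * #R)
    (hd : lam * #C ≤ #{y ∈ C | y ∈ A})
    (hRA : ∀ g, (#{r ∈ R | g * r ∈ A} : ℝ) ≤ 101 / 100 * lam * #R)
    (hRA₂ : ∀ g, (#{r ∈ R₂ | g * r ∈ A} : ℝ) ≤ 101 / 100 * lam * #R₂) :
    (#{y ∈ C | y ∈ A ∧ (#{r ∈ R | y * r ∈ A} : ℝ) < 7 / 8 * lam * #R} : ℝ) ≤
      lam / 4 * #C := by
  have hR0 : (0 : ℝ) < #R := by exact_mod_cast hRne.card_pos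
  have hR₂0 : (0 : ℝ) < #R₂ := by exact_mod_cast hR₂ne.card_pos
  set bad := {y ∈ C | y ∈ A ∧ (#{r ∈ R | y * r ∈ A} : ℝ) < 7 / 8 * lam * #R} with hbad
  -- The average density of `A` on w*R over w in `C` is at least lam - eps, and no value exceeds
  -- 1.01·lam. So `E` is a small proportion of `C`: each of its points loses 1.01 - 15/16 =
  -- 145/2000, against a total loss of at most 11/1000. This alone does not compare with |A ∩ C|;
  -- the second scale `R₂` supplies the missing factor lam.
  set E := {g ∈ C | (#{r ∈ R | g * r ∈ A} : ℝ) ≤ 15 / 16 * lam * #R} with hE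
  have hEcard : 145 / 2000 * lam * #E ≤ 11 / 1000 * lam * #C := by
    have h1 : (lam - eps) * #C * #R ≤ ∑ w ∈ C, (#{r ∈ R | w * r ∈ A} : ℝ) := by
      rw [sum_card_filter_comm C R (fun w r => w * r ∈ A)]
      calc _ = ∑ _r ∈ R, (lam - eps) * #C := by rw [sum_const, nsmul_eq_mul]; ring
        _ ≤ _ := sum_le_sum fun r hr => card_translate_ge A C lam eps r hd (hC r hr)
    have h2 : ∑ w ∈ C, (#{r ∈ R | w * r ∈ A} : ℝ) ≤
        ∑ w ∈ C, (101 / 100 * lam * #R -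
          if (#{r ∈ R | w * r ∈ A} : ℝ) ≤ 15 / 16 * lam * #R then 145 / 2000 * lam * #R else 0) := by
      refine sum_le_sum fun w _ => ?_
      split_ifs with h
      · linarith
      · linarith [hRA w]
    rw [sum_sub_distrib, sum_const, ← sum_filter, sum_const, nsmul_eq_mul, nsmul_eq_mul] at h2
    have h3 := h1.trans h2
    rw [← hE] at h3
    have h4 : (145 / 2000 * lam * #E) * #R ≤ (11 / 1000 * lam * #C) * #R := by
      have h5 : eps * (#C * #R) ≤ lam / 1000 * (#C * #R) := by gcongr
      nlinarith
    exact le_of_mul_le_mul_right h4 hR0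
  -- A bad y shifted by r⁻¹ lands in `E`, since `R` is almost `R₂`-invariant, and y = (y*r⁻¹)*r is
  -- in `A`. Averaging over r uses that `A` has density at most 1.01·lam on g*R₂ for g in `E`.
  have hpair : ∀ r ∈ R₂, (#bad : ℝ) ≤ eps * #C + #{g ∈ E | g * r ∈ A} := by
    intro r hr
    have h1 : bad ⊆ {y ∈ C | y * r⁻¹ ∉ C} ∪ ({g ∈ E | g * r ∈ A} : Finset G).image (· * r) := by
      intro y hy
      obtain ⟨hyC, hyA, hlt⟩ := mem_filter.1 hy
      by_cases h : y * r⁻¹ ∈ C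
      · refine mem_union_right _ (mem_image.2 ⟨y * r⁻¹, mem_filter.2 ⟨mem_filter.2 ⟨h, ?_⟩, ?_⟩, ?_⟩)
        · have h2 : #{s ∈ R | y * r⁻¹ * s ∈ A} ≤ #{s ∈ R | y * s ∈ A} + #{s ∈ R | r⁻¹ * s ∉ R} := by
            have h3 : ({s ∈ R | y * r⁻¹ * s ∈ A} : Finset G) ⊆
                ({s ∈ R | y * s ∈ A} : Finset G).image (r * ·) ∪ {s ∈ R | r⁻¹ * s ∉ R} := by
              intro s hs
              obtain ⟨hsR, hsA⟩ := mem_filter.1 hs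
              by_cases h' : r⁻¹ * s ∈ R
              · refine mem_union_left _ (mem_image.2 ⟨r⁻¹ * s, mem_filter.2 ⟨h', ?_⟩, ?_⟩)
                · rwa [← mul_assoc]
                · simp
              · exact mem_union_right _ (mem_filter.2 ⟨hsR, h'⟩)
            exact card_le_add_of_subset_image_union h3
          have h4 : (#{s ∈ R | y * r⁻¹ * s ∈ A} : ℝ) ≤
            #{s ∈ R | y * s ∈ A} + #{s ∈ R | r⁻¹ * s ∉ R} := by exact_mod_cast h2
          have h5 := hR r hr
          have h6 : eps * #R ≤ lam / 1000 * #R := by gcongr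
          have h7 : 0 < lam * #R := by positivity
          linarith
        · simpa using hyA
        · simp
      · exact mem_union_left _ (mem_filter.2 ⟨hyC, h⟩)
    have h2 : #bad ≤ #{y ∈ C | y * r⁻¹ ∉ C} + #{g ∈ E | g * r ∈ A} := by
      rw [union_comm] at h1
      rw [add_comm]
      exact card_le_add_of_subset_image_union h1
    have h3 : (#bad : ℝ) ≤ #{y ∈ C | y * r⁻¹ ∉ C} + #{g ∈ E | g * r ∈ A} := by exact_mod_cast h2
    linarith [hC₂ r hr]
  have hsum : (#bad : ℝ) * #R₂ ≤ eps * #C * #R₂ + #E * (101 / 100 * lam * #R₂) := by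
    calc (#bad : ℝ) * #R₂ = ∑ _r ∈ R₂, (#bad : ℝ) := by rw [sum_const, nsmul_eq_mul]; ring
      _ ≤ ∑ r ∈ R₂, (eps * #C + #{g ∈ E | g * r ∈ A}) := sum_le_sum hpair
      _ = eps * #C * #R₂ + ∑ g ∈ E, (#{r ∈ R₂ | g * r ∈ A} : ℝ) := by
        rw [sum_add_distrib, sum_const, nsmul_eq_mul,
          sum_card_filter_comm E R₂ (fun g r => g * r ∈ A)]
        ring
      _ ≤ eps * #C * #R₂ + ∑ _g ∈ E, 101 / 100 * lam * #R₂ := by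
        gcongr with g hg
        exact hRA₂ g
      _ = _ := by rw [sum_const, nsmul_eq_mul]
  have h8 : (#bad : ℝ) ≤ eps * #C + #E * (101 / 100 * lam) := by
    refine le_of_mul_le_mul_right (hsum.trans_eq ?_) hR₂0
    ring
  have h9 : eps * #C ≤ lam / 1000 * #C := by gcongr
  have h10 : 0 ≤ lam * #C := by positivity
  linarith

theorem card_sparse_left_le (A C R R₂ : Finset G) (lam eps : ℝ) (hlam : 0 < lam)
    (heps : eps ≤ lam / 1000) (hRne : R.Nonempty) (hR₂ne : R₂.Nonempty)
    (hRinv : R⁻¹ = R) (hR₂inv : R₂⁻¹ = R₂)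
    (hC : ∀ r ∈ R, (#{y ∈ C | r * y ∉ C} : ℝ) ≤ eps * #C)
    (hC₂ : ∀ r ∈ R₂, (#{y ∈ C | r * y ∉ C} : ℝ) ≤ eps * #C)
    (hR : ∀ r ∈ R₂, (#{s ∈ R | r⁻¹ * s ∉ R} : ℝ) ≤ eps * #R)
    (hd : lam * #C ≤ #{y ∈ C | y ∈ A})
    (hRA : ∀ g, (#{r ∈ R | r * g ∈ A} : ℝ) ≤ 101 / 100 * lam * #R)
    (hRA₂ : ∀ g, (#{r ∈ R₂ | r * g ∈ A} : ℝ) ≤ 101 / 100 * lam * #R₂) :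
    (#{y ∈ C | y ∈ A ∧ (#{r ∈ R | r * y ∈ A} : ℝ) < 7 / 8 * lam * #R} : ℝ) ≤
      lam / 4 * #C := by
  have hcardinv : ∀ (p : G → Prop) [DecidablePred p], #{y ∈ C⁻¹ | p y} = #{y ∈ C | p y⁻¹} := by
    intro p _
    refine card_bij' (fun r _ => r⁻¹) (fun r _ => r⁻¹) ?_ ?_ (by simp) (by simp)
    · intro r hr
      obtain ⟨h1, h2⟩ := mem_filter.1 hr
      exact mem_filter.2 ⟨mem_inv'.1 h1, by rwa [inv_inv]⟩
    · intro r hr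
      obtain ⟨h1, h2⟩ := mem_filter.1 hr
      exact mem_filter.2 ⟨inv_mem_inv h1, h2⟩
  have hleft : ∀ {S : Finset G}, S⁻¹ = S → ∀ g, #{r ∈ S | g * r ∈ A⁻¹} = #{r ∈ S | r * g⁻¹ ∈ A} := by
    intro S hS g
    rw [← card_filter_inv hS]
    simp [mem_inv']
  have hCC : ∀ r, #{y ∈ C⁻¹ | y * r⁻¹ ∉ C⁻¹} = #{y ∈ C | r * y ∉ C} := by
    intro r
    rw [hcardinv]
    simp [mem_inv']
  -- Inversion swaps left and right; the hypothesis relating `R` and `R₂` needs no change.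
  have h := card_sparse_le A⁻¹ C⁻¹ R R₂ lam eps hlam heps hRne hR₂ne
    (fun r hr => by rw [hCC, card_inv]; exact hC r hr)
    (fun r hr => by rw [hCC, card_inv]; exact hC₂ r hr) hR
    (by rw [hcardinv, card_inv]; simpa using hd)
    (fun g => by rw [hleft hRinv]; exact hRA _) (fun g => by rw [hleft hR₂inv]; exact hRA₂ _)
  rw [hcardinv, card_inv] at h
  simp only [hleft hRinv] at h
  simp only [mem_inv', inv_inv] at h
  exact h

end

/-! ### Translates meeting on average, and counting products in a dense set -/

section
variable {G : Type*} [Group G] [Fintype G] [DecidableEq G]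

/-- Averaging over b: the counts sum to |X||T|. -/
theorem exists_card_filter_mul_right (X T : Finset G) :
    ∃ b : G, #X * #T ≤ Fintype.card G * #{x ∈ X | x * b ∈ T} := by
  have h1 : ∑ b : G, #{x ∈ X | x * b ∈ T} = #X * #T := by
    have h2 : ∑ b : G, #{x ∈ X | x * b ∈ T} = ∑ x ∈ X, #{b : G | x * b ∈ T} := by
      simp only [card_eq_sum_ones, sum_filter]
      rw [sum_comm]
    rw [h2, sum_const_nat]
    intro x _
    refine card_bij' (fun b _ => x * b) (fun t _ => x⁻¹ * t) ?_ ?_ (by simp) (by simp)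
    · simp
    · simp
  by_contra hcon
  push Not at hcon
  have h3 : ∑ b : G, Fintype.card G * #{x ∈ X | x * b ∈ T} < ∑ _b : G, #X * #T :=
    sum_lt_sum_of_nonempty univ_nonempty fun b _ => hcon b
  rw [← mul_sum, h1, sum_const, card_univ, smul_eq_mul] at h3
  exact lt_irrefl _ h3

theorem exists_card_filter_mul_left (X T : Finset G) :
    ∃ a : G, #X * #T ≤ Fintype.card G * #{x ∈ X | a * x ∈ T} := by
  have h1 : ∑ b : G, #{x ∈ X | b * x ∈ T} = #X * #T := by
    have h2 : ∑ b : G, #{x ∈ X | b * x ∈ T} = ∑ x ∈ X, #{b : G | b * x ∈ T} := by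
      simp only [card_eq_sum_ones, sum_filter]
      rw [sum_comm]
    rw [h2, sum_const_nat]
    intro x _
    refine card_bij' (fun b _ => b * x) (fun t _ => t * x⁻¹) ?_ ?_ (by simp) (by simp)
    · simp
    · simp
  by_contra hcon
  push Not at hcon
  have h3 : ∑ b : G, Fintype.card G * #{x ∈ X | b * x ∈ T} < ∑ _b : G, #X * #T :=
    sum_lt_sum_of_nonempty univ_nonempty fun b _ => hcon b
  rw [← mul_sum, h1, sum_const, card_univ, smul_eq_mul] at h3
  exact lt_irrefl _ h3

/-- Without density increments the normalised number of solutions `c * d ∈ V` is large. -/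
theorem le_sum_hitDensity (R U V Ω X Z : Finset G) (lam eps : ℝ) (hlam : 0 < lam)
    (heps : eps ≤ 1 / 1000) (hRne : R.Nonempty) (hUne : U.Nonempty) (hVne : V.Nonempty)
    (hRinv : R⁻¹ = R) (hUinv : U⁻¹ = U) (hXR : X ⊆ R)
    (hX : 7 / 8 * lam * #R ≤ #X) (hZ : 7 / 8 * lam * #R ≤ #{d ∈ R | d ∈ Z})
    (hΩ₁ : U * V * R ⊆ Ω) (hΩ₂ : U * R ⊆ Ω) (hΩ : (#Ω : ℝ) ≤ (1 + eps) * #R)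
    (hU₁ : ∀ c, (#{u ∈ U | u * c ∈ X} : ℝ) ≤ 101 / 100 * lam * #U)
    (hU₂ : ∀ c, ∀ v ∈ V, (#{u ∈ U | v⁻¹ * (u * c) ∈ Z⁻¹} : ℝ) ≤ 101 / 100 * lam * #U)
    (hap : ∀ τ ∈ U * U, (#{g | lam ^ 2 / 20 < |hitDensity V Z⁻¹ (τ * g) -
      hitDensity V Z⁻¹ g|} : ℝ) ≤ lam ^ 2 / 20 * #R) :
    lam ^ 2 / 4 * #R ≤ ∑ c ∈ X, hitDensity V Z⁻¹ c := by
  by_contra hcon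
  push Not at hcon
  set F := hitDensity V Z⁻¹ with hF
  have hR0 : (0 : ℝ) < #R := by exact_mod_cast hRne.card_pos
  have hU0 : (0 : ℝ) < #U := by exact_mod_cast hUne.card_pos
  have hV0 : (0 : ℝ) < #V := by exact_mod_cast hVne.card_pos
  have hXR' : (#X : ℝ) ≤ #R := by exact_mod_cast card_le_card hXR
  have hmemU : ∀ u ∈ U, u⁻¹ ∈ U := fun u hu => by rw [← hUinv]; exact inv_mem_inv hu
  let L : G → ℝ := fun c => #{u ∈ U | u * c ∈ X}
  let F₁ : G → ℝ := fun c => ∑ u ∈ U, F (u * c)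
  -- The assumed upper bound lam²/4, plus lam²/20 for the drift and lam²/20 for the exceptional set.
  have hshift : ∀ τ ∈ U * U, ∑ x ∈ X, F (τ * x) ≤ 35 / 100 * lam ^ 2 * #R := by
    intro τ hτ
    have h1 : ∑ x ∈ X, F (τ * x) ≤
        ∑ x ∈ X, (F x + lam ^ 2 / 20 + if lam ^ 2 / 20 < |F (τ * x) - F x| then 1 else 0) := by
      refine sum_le_sum fun x _ => ?_
      split_ifs with h
      · have := hitDensity_le_one V Z⁻¹ (τ * x)
        have := hitDensity_nonneg V Z⁻¹ x
        nlinarith [sq_nonneg lam]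
      · have := (abs_le.1 (not_lt.1 h)).2
        linarith
    rw [sum_add_distrib, sum_add_distrib, sum_const, nsmul_eq_mul, sum_boole] at h1
    have h2 : (#{x ∈ X | lam ^ 2 / 20 < |F (τ * x) - F x|} : ℝ) ≤
        #{g | lam ^ 2 / 20 < |F (τ * g) - F g|} := by
      exact_mod_cast card_le_card (filter_subset_filter _ (subset_univ _))
    have h3 := hap τ hτ
    have h4 : (#X : ℝ) * (lam ^ 2 / 20) ≤ #R * (lam ^ 2 / 20) := by gcongr
    linarith
  have hLF : ∑ c : G, L c * F₁ c ≤ 35 / 100 * lam ^ 2 * #R * (#U * #U) := by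
    have h1 : ∀ u : G, ∀ u' : G,
        ∑ c : G, (if u * c ∈ X then (1 : ℝ) else 0) * F (u' * c) = ∑ x ∈ X, F (u' * u⁻¹ * x) := by
      intro u u'
      rw [← Fintype.sum_equiv (Equiv.mulLeft u⁻¹)
        (fun x => (if x ∈ X then F (u' * u⁻¹ * x) else 0))]
      · simp
      · intro x
        simp [mul_assoc]
    calc ∑ c : G, L c * F₁ c =
        ∑ c : G, ∑ u ∈ U, ∑ u' ∈ U, (if u * c ∈ X then (1 : ℝ) else 0) * F (u' * c) := by
          refine sum_congr rfl fun c _ => ?_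
          simp only [L, F₁]
          rw [← sum_boole, sum_mul_sum]
      _ = ∑ u ∈ U, ∑ u' ∈ U, ∑ x ∈ X, F (u' * u⁻¹ * x) := by
          rw [sum_comm]
          refine sum_congr rfl fun u _ => ?_
          rw [sum_comm]
          exact sum_congr rfl fun u' _ => h1 u u'
      _ ≤ ∑ u ∈ U, ∑ u' ∈ U, 35 / 100 * lam ^ 2 * #R :=
          sum_le_sum fun u hu => sum_le_sum fun u' hu' =>
            hshift _ (mul_mem_mul hu' (hmemU u hu))
      _ = _ := by simp only [sum_const, nsmul_eq_mul]; ring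
  have hL0 : ∀ c, c ∉ Ω → L c = 0 := by
    intro c hc
    simp only [L, Nat.cast_eq_zero, card_eq_zero]
    rw [filter_eq_empty_iff]
    intro u hu hx
    refine hc (hΩ₂ ?_)
    have := mul_mem_mul (hmemU u hu) (hXR hx)
    simpa using this
  have hLsum : ∑ c : G, L c = #U * #X := by
    simp only [L]
    rw [sum_card_filter_comm univ U (fun c u => u * c ∈ X)]
    have : ∀ u ∈ U, (#{c : G | u * c ∈ X} : ℝ) = #X := by
      intro u _
      norm_cast
      refine card_bij' (fun b _ => u * b) (fun t _ => u⁻¹ * t) ?_ ?_ (by simp) (by simp)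
      · simp
      · simp
    rw [sum_congr rfl this, sum_const, nsmul_eq_mul]
  have hF₁ : ∀ c, F₁ c = (∑ v ∈ V, (#{u ∈ U | v⁻¹ * (u * c) ∈ Z⁻¹} : ℝ)) / #V := by
    intro c
    simp only [F₁, hF, hitDensity]
    rw [← sum_div, sum_card_filter_comm U V (fun u v => v⁻¹ * (u * c) ∈ Z⁻¹)]
  have hF₁le : ∀ c, F₁ c ≤ 101 / 100 * lam * #U := by
    intro c
    rw [hF₁, div_le_iff₀ hV0]
    calc _ ≤ ∑ _v ∈ V, 101 / 100 * lam * #U := sum_le_sum fun v hv => hU₂ c v hv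
      _ = _ := by rw [sum_const, nsmul_eq_mul]; ring
  have hF₁sum : 7 / 8 * lam * #R * #U ≤ ∑ c ∈ Ω, F₁ c := by
    have h1 : ∀ u ∈ U, ∀ v ∈ V, 7 / 8 * lam * #R ≤ #{c ∈ Ω | v⁻¹ * (u * c) ∈ Z⁻¹} := by
      intro u hu v hv
      refine hZ.trans ?_
      have : #{d ∈ R | d ∈ Z} ≤ #{c ∈ Ω | v⁻¹ * (u * c) ∈ Z⁻¹} := by
        refine card_le_card_of_injOn (fun d => u⁻¹ * v * d⁻¹) ?_ ?_
        · intro d hd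
          obtain ⟨hdR, hdZ⟩ := mem_filter.1 (mem_coe.1 hd)
          refine mem_coe.2 (mem_filter.2 ⟨hΩ₁ ?_, ?_⟩)
          · exact mul_mem_mul (mul_mem_mul (hmemU u hu) hv) (by rw [← hRinv]; exact inv_mem_inv hdR)
          · have : v⁻¹ * (u * (u⁻¹ * v * d⁻¹)) = d⁻¹ := by group
            rw [this]; exact inv_mem_inv hdZ
        · intro d _ d' _ h
          exact inv_injective (mul_left_cancel h)
      exact_mod_cast this
    calc 7 / 8 * lam * #R * #U = ∑ u ∈ U, 7 / 8 * lam * #R := by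
          rw [sum_const, nsmul_eq_mul]; ring
      _ ≤ ∑ u ∈ U, ∑ c ∈ Ω, F (u * c) := by
          refine sum_le_sum fun u hu => ?_
          simp only [hF, hitDensity]
          rw [← sum_div, le_div_iff₀ hV0,
            sum_card_filter_comm Ω V (fun c v => v⁻¹ * (u * c) ∈ Z⁻¹)]
          calc _ = ∑ _v ∈ V, 7 / 8 * lam * #R := by rw [sum_const, nsmul_eq_mul]; ring
            _ ≤ _ := sum_le_sum fun v hv => h1 u hu v hv
      _ = _ := by rw [sum_comm]
  have hLnn : ∀ c, 0 ≤ L c := fun c => by positivity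
  -- Both `L` and `F₁` are at most m = 1.01·lam·|U|, so the sum of (m - L)(m - F₁) over `Ω` is
  -- nonnegative. Inserting the two means gives ∑ L·F₁ at least about 0.74·lam²|R||U|²,
  -- contradicting the factor 0.35 in `hLF`.
  have hmain : ∑ c ∈ Ω, L c * (101 / 100 * lam * #U - F₁ c) ≤
      101 / 100 * lam * #U * ∑ c ∈ Ω, (101 / 100 * lam * #U - F₁ c) := by
    rw [mul_sum]
    refine sum_le_sum fun c _ => mul_le_mul_of_nonneg_right (hU₁ c) ?_
    linarith [hF₁le c]
  have h1 : ∑ c ∈ Ω, L c * (101 / 100 * lam * #U - F₁ c) =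
      101 / 100 * lam * #U * (#U * #X) - ∑ c : G, L c * F₁ c := by
    have h2 : ∑ c ∈ Ω, L c * (101 / 100 * lam * #U - F₁ c) =
        ∑ c : G, L c * (101 / 100 * lam * #U - F₁ c) :=
      sum_subset (subset_univ _) fun c _ hc => by rw [hL0 c hc, zero_mul]
    rw [h2]
    simp only [mul_sub, sum_sub_distrib]
    rw [← sum_mul, hLsum]
    ring
  rw [h1, sum_sub_distrib, sum_const, nsmul_eq_mul] at hmain
  have h3 : (#Ω : ℝ) ≤ 1001 / 1000 * #R := by nlinarith
  have h4 : 0 < lam * #U := by positivity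
  have h5 : (lam * #U) * (#Ω : ℝ) ≤ (lam * #U) * (1001 / 1000 * #R) := by gcongr
  have h6 : (lam * #U) * (#U * (7 / 8 * lam * #R)) ≤ (lam * #U) * (#U * #X) := by gcongr
  have h7 : 101 / 100 * lam * #U * (#Ω * (101 / 100 * lam * #U) - ∑ c ∈ Ω, F₁ c) ≤
      101 / 100 * lam * #U * (101 / 100 * (lam * #U * (1001 / 1000 * #R)) - 7 / 8 * lam * #R * #U) := by
    refine mul_le_mul_of_nonneg_left ?_ (by positivity)
    linarith
  have h8 : 0 < lam ^ 2 * #R * (#U * #U) := by positivity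
  nlinarith

end

/-! ### Almost invariance of cells, and recovering triples -/

section
variable {G : Type*} [Group G] [DecidableEq G]

theorem card_mul_left_notMem_le {T U : Finset G} (h1 : 1 ∈ T) {eps : ℝ} {n : ℕ}
    (h : (#(T ^ n * U * T ^ n) : ℝ) ≤ (1 + eps) * #U) {t : G} (ht : t ∈ T ^ n) :
    (#{u ∈ U | t * u ∉ U} : ℝ) ≤ eps * #U := by
  have h1n : (1 : G) ∈ T ^ n := one_mem_pow h1
  have hsub : U ⊆ T ^ n * U * T ^ n := fun u hu => by
    simpa using mul_mem_mul (mul_mem_mul h1n hu) h1n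
  have h2 : #{u ∈ U | t * u ∉ U} ≤ #((T ^ n * U * T ^ n) \ U) := by
    refine card_le_card_of_injOn (fun u => t * u) ?_ fun u _ u' _ h => mul_left_cancel h
    intro u hu
    obtain ⟨hu, hn⟩ := mem_filter.1 (mem_coe.1 hu)
    refine mem_coe.2 (mem_sdiff.2 ⟨?_, hn⟩)
    simpa using mul_mem_mul (mul_mem_mul ht hu) h1n
  have h3 := card_sdiff_add_card_eq_card hsub
  have h4 : (#((T ^ n * U * T ^ n) \ U) : ℝ) + #U = #(T ^ n * U * T ^ n) := by exact_mod_cast h3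
  have h5 : (#{u ∈ U | t * u ∉ U} : ℝ) ≤ #((T ^ n * U * T ^ n) \ U) := by exact_mod_cast h2
  linarith

theorem card_mul_right_notMem_le {T U : Finset G} (h1 : 1 ∈ T) {eps : ℝ} {n : ℕ}
    (h : (#(T ^ n * U * T ^ n) : ℝ) ≤ (1 + eps) * #U) {t : G} (ht : t ∈ T ^ n) :
    (#{u ∈ U | u * t ∉ U} : ℝ) ≤ eps * #U := by
  have h1n : (1 : G) ∈ T ^ n := one_mem_pow h1
  have hsub : U ⊆ T ^ n * U * T ^ n := fun u hu => by
    simpa using mul_mem_mul (mul_mem_mul h1n hu) h1n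
  have h2 : #{u ∈ U | u * t ∉ U} ≤ #((T ^ n * U * T ^ n) \ U) := by
    refine card_le_card_of_injOn (fun u => u * t) ?_ fun u _ u' _ h => mul_right_cancel h
    intro u hu
    obtain ⟨hu, hn⟩ := mem_filter.1 (mem_coe.1 hu)
    refine mem_coe.2 (mem_sdiff.2 ⟨?_, hn⟩)
    simpa using mul_mem_mul (mul_mem_mul h1n hu) ht
  have h3 := card_sdiff_add_card_eq_card hsub
  have h4 : (#((T ^ n * U * T ^ n) \ U) : ℝ) + #U = #(T ^ n * U * T ^ n) := by exact_mod_cast h3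
  have h5 : (#{u ∈ U | u * t ∉ U} : ℝ) ≤ #((T ^ n * U * T ^ n) \ U) := by exact_mod_cast h2
  linarith

theorem card_filter_image_cell (U : Finset G) (g h : G) (p : G → Prop) [DecidablePred p] :
    #{y ∈ U.image (fun u => g * u * h) | p y} = #{u ∈ U | p (g * u * h)} := by
  rw [filter_image, card_image_of_injective]
  intro u u' huu
  exact mul_left_cancel (mul_right_cancel huu)

theorem card_image_cell (U : Finset G) (g h : G) :
    #(U.image (fun u => g * u * h)) = #U :=
  card_image_of_injective _ fun _ _ huu => mul_left_cancel (mul_right_cancel huu)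

theorem mem_image_cell {U : Finset G} {g h y : G} :
    y ∈ U.image (fun u => g * u * h) ↔ g⁻¹ * y * h⁻¹ ∈ U := by
  rw [mem_image]
  constructor
  · rintro ⟨u, hu, rfl⟩
    convert hu using 1
    group
  · intro hy
    exact ⟨_, hy, by group⟩

theorem card_cell_mul_right_notMem_le {T U : Finset G} (h1 : 1 ∈ T) {eps : ℝ} {n : ℕ}
    (hU : (#(T ^ n * U * T ^ n) : ℝ) ≤ (1 + eps) * #U) (g h : G) {r : G}
    (hr : h * r * h⁻¹ ∈ T ^ n) :
    (#{y ∈ U.image (fun u => g * u * h) | y * r ∉ U.image (fun u => g * u * h)} : ℝ) ≤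
      eps * #(U.image (fun u => g * u * h)) := by
  rw [card_filter_image_cell, card_image_cell]
  convert card_mul_right_notMem_le h1 hU hr using 5 with u
  rw [mem_image_cell]
  have : g⁻¹ * (g * u * h * r) * h⁻¹ = u * (h * r * h⁻¹) := by group
  rw [this]

theorem card_cell_mul_left_notMem_le {T U : Finset G} (h1 : 1 ∈ T) {eps : ℝ} {n : ℕ}
    (hU : (#(T ^ n * U * T ^ n) : ℝ) ≤ (1 + eps) * #U) (g h : G) {r : G}
    (hr : g⁻¹ * r * g ∈ T ^ n) :
    (#{y ∈ U.image (fun u => g * u * h) | r * y ∉ U.image (fun u => g * u * h)} : ℝ) ≤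
      eps * #(U.image (fun u => g * u * h)) := by
  rw [card_filter_image_cell, card_image_cell]
  convert card_mul_left_notMem_le h1 hU hr using 5 with u
  rw [mem_image_cell]
  have : g⁻¹ * (r * (g * u * h)) * h⁻¹ = (g⁻¹ * r * g) * u := by group
  rw [this]

/-- Pairs `(c, v)` with `v = w⁻¹ * y ^ 2 * w⁻¹` produce solutions of `x * z = y ^ 2`. -/
theorem sum_hitDensity_le_card (A X Y Z : Finset G) (w : G)
    (hsq : ∀ a ∈ A, ∀ b ∈ A, a ≠ b → a ^ 2 ≠ b ^ 2) (hY : Y ⊆ A) (hYne : Y.Nonempty)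
    (hX : ∀ c ∈ X, w * c ∈ A) (hZ : ∀ d ∈ Z, d * w ∈ A) :
    (∑ c ∈ X, hitDensity (Y.image fun y => w⁻¹ * y ^ 2 * w⁻¹) Z⁻¹ c) * #Y ≤
      #((A ×ˢ A ×ˢ A).filter (fun t : G × G × G => t.1 * t.2.2 = t.2.1 ^ 2)) := by
  have hinj : Set.InjOn (fun y => w⁻¹ * y ^ 2 * w⁻¹) (Y : Set G) := by
    intro y hy y' hy' h
    by_contra hne
    exact hsq y (hY hy) y' (hY hy') hne (mul_left_cancel (mul_right_cancel h))
  have hcard := card_image_of_injOn hinj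
  have hY0 : (#Y : ℝ) ≠ 0 := by exact_mod_cast hYne.card_pos.ne'
  have h1 : (∑ c ∈ X, hitDensity (Y.image fun y => w⁻¹ * y ^ 2 * w⁻¹) Z⁻¹ c) * #Y =
      ∑ c ∈ X, (#{y ∈ Y | (w⁻¹ * y ^ 2 * w⁻¹)⁻¹ * c ∈ Z⁻¹} : ℝ) := by
    rw [sum_mul]
    refine sum_congr rfl fun c _ => ?_
    rw [hitDensity, hcard, div_mul_cancel₀ _ hY0, filter_image, card_image_of_injOn]
    exact hinj.mono (by exact_mod_cast filter_subset _ _)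
  have h2 : (∑ c ∈ X, (#{y ∈ Y | (w⁻¹ * y ^ 2 * w⁻¹)⁻¹ * c ∈ Z⁻¹} : ℝ)) =
      #{p ∈ X ×ˢ Y | (w⁻¹ * p.2 ^ 2 * w⁻¹)⁻¹ * p.1 ∈ Z⁻¹} := by
    norm_cast
    simp only [card_eq_sum_ones, sum_filter]
    rw [sum_product]
  rw [h1, h2]
  norm_cast
  -- Here x = w*c and z = d*w with d = c⁻¹v, so x*z = w*v*w = y². The pair (c, y) can be read off
  -- from the first two coordinates.
  refine card_le_card_of_injOn
    (fun p => (w * p.1, p.2, p.1⁻¹ * (w⁻¹ * p.2 ^ 2 * w⁻¹) * w)) ?_ ?_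
  · rintro ⟨c, y⟩ hp
    obtain ⟨hp1, hp2⟩ := mem_filter.1 (mem_coe.1 hp)
    obtain ⟨hc, hy⟩ := mem_product.1 hp1
    have h3 := hZ _ (mem_inv'.1 hp2)
    rw [mul_inv_rev, inv_inv] at h3
    simp only [mem_coe, mem_filter, mem_product]
    refine ⟨⟨hX c hc, hY hy, h3⟩, ?_⟩
    group
  · rintro ⟨c, y⟩ _ ⟨c', y'⟩ _ h
    simp only [Prod.mk.injEq] at h
    exact Prod.ext (mul_left_cancel h.1) h.2.1

end

/-! ### The density increment step -/

section
variable {G : Type*} [Group G] [Fintype G] [DecidableEq G]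

/-- `A` has density at least `lam` on a two-sided translate of an almost invariant set; the sets
involved have density at least `exp (-ℓ)`. -/
def HasDenseCell (A : Finset G) (lam eps : ℝ) (ℓ : ℕ) : Prop :=
  ∃ (U T : Finset G) (g h : G), 1 ∈ T ∧ T⁻¹ = T ∧
    Real.exp (-ℓ) * Fintype.card G ≤ #U ∧ Real.exp (-ℓ) * Fintype.card G ≤ #T ∧
    (#(T ^ 24 * U * T ^ 24) : ℝ) ≤ (1 + eps) * #U ∧
    lam * #U ≤ #{u ∈ U | g * u * h ∈ A}

theorem HasDenseCell.lam_le_one {A : Finset G} {lam eps : ℝ} {ℓ : ℕ}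
    (hA : HasDenseCell A lam eps ℓ) : lam ≤ 1 := by
  obtain ⟨U, T, g, h, -, -, hU, -, -, hd⟩ := hA
  have hN : (0 : ℝ) < Fintype.card G := by exact_mod_cast (Fintype.card_pos : 0 < Fintype.card G)
  have hU0 : (0 : ℝ) < #U := lt_of_lt_of_le (by positivity) hU
  have h1 : (#{u ∈ U | g * u * h ∈ A} : ℝ) ≤ #U := by exact_mod_cast card_filter_le _ _
  by_contra hcon
  push Not at hcon
  nlinarith

/-- Translates of two dense sets intersect in a dense set. -/
theorem exists_common_refinement (T : Finset G) (hinv : T⁻¹ = T) (g h : G) (ℓ : ℝ)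
    (hT : Real.exp (-ℓ) * Fintype.card G ≤ #T) :
    ∃ Q : Finset G, Real.exp (-(2 * ℓ)) * Fintype.card G ≤ #Q ∧
      (∀ x ∈ Q * Q⁻¹, g⁻¹ * x * g ∈ T ^ 2) ∧ (∀ x ∈ Q * Q⁻¹, h * x * h⁻¹ ∈ T ^ 2) := by
  have hN : (0 : ℝ) < Fintype.card G := by exact_mod_cast (Fintype.card_pos : 0 < Fintype.card G)
  -- The translation by b cancels in x*x'⁻¹, so a large intersection of gTg⁻¹ with a right translate
  -- of h⁻¹Th controls both conjugates of QQ⁻¹. The average intersection |T|²/|G| explains the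
  -- exponent 2ℓ.
  obtain ⟨b, hb⟩ := exists_card_filter_mul_right (T.image fun t => g * t * g⁻¹)
    (T.image fun t => h⁻¹ * t * h)
  rw [card_image_cell, card_image_cell] at hb
  have hsq : T ^ 2 = T * T⁻¹ := by rw [hinv, pow_two]
  refine ⟨{x ∈ T.image fun t => g * t * g⁻¹ | x * b ∈ T.image fun t => h⁻¹ * t * h}, ?_, ?_, ?_⟩
  rotate_left
  · intro x hx
    obtain ⟨a, ha, c', hc', rfl⟩ := mem_mul.1 hx
    obtain ⟨c, hc, rfl⟩ := mem_inv.1 hc'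
    have ha1 := mem_image_cell.1 (mem_filter.1 ha).1
    have hc1 := mem_image_cell.1 (mem_filter.1 hc).1
    rw [hsq]
    convert mul_mem_mul ha1 (inv_mem_inv hc1) using 1
    group
  · intro x hx
    obtain ⟨a, ha, c', hc', rfl⟩ := mem_mul.1 hx
    obtain ⟨c, hc, rfl⟩ := mem_inv.1 hc'
    have ha1 := mem_image_cell.1 (mem_filter.1 ha).2
    have hc1 := mem_image_cell.1 (mem_filter.1 hc).2
    rw [hsq]
    convert mul_mem_mul ha1 (inv_mem_inv hc1) using 1
    group
  · have h1 : (#T : ℝ) * #T ≤ Fintype.card G *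
        #{x ∈ T.image fun t => g * t * g⁻¹ | x * b ∈ T.image fun t => h⁻¹ * t * h} := by
      exact_mod_cast hb
    have h2 : (Real.exp (-ℓ) * Fintype.card G) * (Real.exp (-ℓ) * Fintype.card G) ≤ #T * #T := by
      gcongr
    refine le_of_mul_le_mul_left ?_ hN
    refine le_trans (le_of_eq ?_) (h2.trans h1)
    rw [show -(2 * ℓ) = -ℓ + -ℓ by ring, Real.exp_add]
    ring

/-- The form in which failure of the increment is used: an upper bound on every two-sided translate
of each auxiliary regular set, provided its parameters fit under `ℓ`. -/
theorem card_cell_le_of_not_hasDenseCell {A : Finset G} {lam eps : ℝ} {ℓ m : ℕ}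
    (hno : ¬ HasDenseCell A lam eps ℓ) (hm : 1 / (m : ℝ) ≤ eps) {U T : Finset G} {a b : ℝ}
    (h1 : 1 ∈ T) (hinv : T⁻¹ = T)
    (hU : Real.exp (-a) * Fintype.card G ≤ #U) (ha : a ≤ ℓ)
    (hT : Real.exp (-b) * Fintype.card G ≤ #T) (hb : b ≤ ℓ)
    (hUT : (#(T ^ 24 * U * T ^ 24) : ℝ) ≤ (1 + 1 / (m : ℝ)) * #U) (g h : G) :
    (#{u ∈ U | g * u * h ∈ A} : ℝ) ≤ lam * #U := by
  by_contra hcon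
  push Not at hcon
  refine hno ⟨U, T, g, h, h1, hinv, le_trans ?_ hU, le_trans ?_ hT, hUT.trans ?_, hcon.le⟩ <;>
    gcongr

/-- In the absence of density increments, a dense part of `A` clusters around some `w` such that
`A` is not sparse on both `w * R` and `R * w`. -/
theorem exists_cluster (A U T R T₁ R₂ : Finset G) (g h : G) (lam eps : ℝ) (hlam : 0 < lam)
    (heps : eps ≤ lam / 1000) (hUne : U.Nonempty) (hRne : R.Nonempty) (hR₂ne : R₂.Nonempty)
    (hT₁ : 1 ∈ T₁) (hT : 1 ∈ T) (hT₁inv : T₁⁻¹ = T₁)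
    (hRinv : R⁻¹ = R) (hR₂inv : R₂⁻¹ = R₂)
    (hUT : (#(T ^ 24 * U * T ^ 24) : ℝ) ≤ (1 + eps) * #U)
    (hRT : (#(T₁ ^ 24 * R * T₁ ^ 24) : ℝ) ≤ (1 + eps) * #R)
    (hRg : ∀ r ∈ R, g⁻¹ * r * g ∈ T ^ 24) (hRh : ∀ r ∈ R, h * r * h⁻¹ ∈ T ^ 24)
    (hR₂g : ∀ r ∈ R₂, g⁻¹ * r * g ∈ T ^ 24) (hR₂h : ∀ r ∈ R₂, h * r * h⁻¹ ∈ T ^ 24)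
    (hR₂ : R₂ ⊆ T₁ ^ 24)
    (hd : lam * #U ≤ #{u ∈ U | g * u * h ∈ A})
    (hRA : ∀ g h, (#{r ∈ R | g * r * h ∈ A} : ℝ) ≤ 101 / 100 * lam * #R)
    (hRA₂ : ∀ g h, (#{r ∈ R₂ | g * r * h ∈ A} : ℝ) ≤ 101 / 100 * lam * #R₂) :
    ∃ Y ⊆ A, ∃ w ∈ Y, 7 / 8 * lam * #R ≤ #{r ∈ R | w * r ∈ A} ∧
      7 / 8 * lam * #R ≤ #{r ∈ R | r * w ∈ A} ∧
      (∀ y ∈ Y, w⁻¹ * y ∈ T₁ ^ 2) ∧ (∀ y ∈ Y, y * w⁻¹ ∈ T₁ ^ 2) ∧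
      lam / 2 * #U * (#T₁ : ℝ) ^ 2 ≤ #Y * (Fintype.card G : ℝ) ^ 2 := by
  set C := U.image (fun u => g * u * h) with hC
  have hCcard : #C = #U := card_image_cell U g h
  have hdC : lam * #C ≤ #{y ∈ C | y ∈ A} := by
    rw [hCcard, hC, card_filter_image_cell]; exact hd
  have hmemR : ∀ r ∈ R, r⁻¹ ∈ R := fun u hu => by rw [← hRinv]; exact inv_mem_inv hu
  have hmemR₂ : ∀ r ∈ R₂, r⁻¹ ∈ R₂ := fun u hu => by rw [← hR₂inv]; exact inv_mem_inv hu
  have hRR : ∀ r ∈ R₂, (#{s ∈ R | r⁻¹ * s ∉ R} : ℝ) ≤ eps * #R := fun r hr =>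
    card_mul_left_notMem_le hT₁ hRT (hR₂ (hmemR₂ r hr))
  have hb₁ := card_sparse_le A C R R₂ lam eps hlam heps hRne hR₂ne
    (fun r hr => card_cell_mul_right_notMem_le hT hUT g h (hRh _ (hmemR r hr)))
    (fun r hr => card_cell_mul_right_notMem_le hT hUT g h (hR₂h _ (hmemR₂ r hr))) hRR hdC
    (fun x => by simpa using hRA x 1) (fun x => by simpa using hRA₂ x 1)
  have hb₂ := card_sparse_left_le A C R R₂ lam eps hlam heps hRne hR₂ne hRinv hR₂inv
    (fun r hr => card_cell_mul_left_notMem_le hT hUT g h (hRg _ hr))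
    (fun r hr => card_cell_mul_left_notMem_le hT hUT g h (hR₂g _ hr)) hRR hdC
    (fun x => by simpa using hRA 1 x) (fun x => by simpa using hRA₂ 1 x)
  set B₁ := {y ∈ C | y ∈ A ∧ (#{r ∈ R | y * r ∈ A} : ℝ) < 7 / 8 * lam * #R} with hB₁
  set B₂ := {y ∈ C | y ∈ A ∧ (#{r ∈ R | r * y ∈ A} : ℝ) < 7 / 8 * lam * #R} with hB₂
  -- Each bad set costs at most lam/4, so half of the guaranteed mass lam·|C| survives.
  set E := {y ∈ C | y ∈ A} \ (B₁ ∪ B₂) with hE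
  have hEcard : lam / 2 * #U ≤ #E := by
    have h1 := le_card_sdiff (B₁ ∪ B₂) ({y ∈ C | y ∈ A})
    rw [← hE] at h1
    have h2 := card_union_le B₁ B₂
    have h3 : #{y ∈ C | y ∈ A} ≤ #E + (#B₁ + #B₂) := by omega
    have h4 : (#{y ∈ C | y ∈ A} : ℝ) ≤ #E + (#B₁ + #B₂) := by exact_mod_cast h3
    rw [hCcard] at hdC hb₁ hb₂
    linarith
  -- Localising to a⁻¹T₁ and then to T₁b⁻¹ makes w⁻¹y and yw⁻¹ both lie in T₁² for any two points,
  -- so any w in `Y` serves as centre.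
  obtain ⟨a, ha⟩ := exists_card_filter_mul_left E T₁
  obtain ⟨b, hb⟩ := exists_card_filter_mul_right ({x ∈ E | a * x ∈ T₁}) T₁
  set Y := {x ∈ ({x ∈ E | a * x ∈ T₁} : Finset G) | x * b ∈ T₁} with hY
  have hYcard : lam / 2 * #U * (#T₁ : ℝ) ^ 2 ≤ #Y * (Fintype.card G : ℝ) ^ 2 := by
    have h1 : #E * #T₁ * #T₁ ≤ Fintype.card G * (Fintype.card G * #Y) := by
      calc _ ≤ Fintype.card G * #{x ∈ E | a * x ∈ T₁} * #T₁ := by gcongr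
        _ = Fintype.card G * (#{x ∈ E | a * x ∈ T₁} * #T₁) := by ring
        _ ≤ _ := by gcongr
    have h2 : (#E : ℝ) * #T₁ * #T₁ ≤ Fintype.card G * (Fintype.card G * #Y) := by
      exact_mod_cast h1
    calc lam / 2 * #U * (#T₁ : ℝ) ^ 2 ≤ #E * (#T₁ : ℝ) ^ 2 := by gcongr
      _ ≤ _ := by linarith
  have hYE : Y ⊆ E := (filter_subset _ _).trans (filter_subset _ _)
  have hYpos : 0 < #Y := by
    by_contra hcon
    have h0 : #Y = 0 := by omega
    rw [h0] at hYcard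
    have hU0 : (0 : ℝ) < #U := by exact_mod_cast hUne.card_pos
    have hT₁0 : (0 : ℝ) < #T₁ := by exact_mod_cast card_pos.2 ⟨1, hT₁⟩
    have : 0 < lam / 2 * #U * (#T₁ : ℝ) ^ 2 := by positivity
    push_cast at hYcard
    linarith
  obtain ⟨w, hw⟩ := card_pos.1 hYpos
  have hwE := hYE hw
  obtain ⟨hwCA, hwB⟩ := mem_sdiff.1 hwE
  obtain ⟨hwC, hwA⟩ := mem_filter.1 hwCA
  have hsq : T₁ ^ 2 = T₁⁻¹ * T₁ := by rw [hT₁inv, pow_two]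
  have hsq' : T₁ ^ 2 = T₁ * T₁⁻¹ := by rw [hT₁inv, pow_two]
  refine ⟨Y, fun y hy => (mem_filter.1 (mem_sdiff.1 (hYE hy)).1).2, w, hw, ?_, ?_, ?_, ?_, hYcard⟩
  · by_contra hcon
    exact hwB (mem_union_left _ (mem_filter.2 ⟨hwC, hwA, not_le.1 hcon⟩))
  · by_contra hcon
    exact hwB (mem_union_right _ (mem_filter.2 ⟨hwC, hwA, not_le.1 hcon⟩))
  · intro y hy
    rw [hsq]
    convert mul_mem_mul (inv_mem_inv (mem_filter.1 (mem_filter.1 hw).1).2)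
      (mem_filter.1 (mem_filter.1 hy).1).2 using 1
    group
  · intro y hy
    rw [hsq']
    convert mul_mem_mul (mem_filter.1 hy).2 (inv_mem_inv (mem_filter.1 hw).2) using 1
    group

/-- A dense symmetric set of almost periods, with a quantitatively convenient choice of
parameters. -/
theorem exists_dense_almostPeriods (T₁ V D : Finset G) (hT₁ : 1 ∈ T₁) (hT₁inv : T₁⁻¹ = T₁)
    (lam : ℝ) (ℓ : ℕ) (hℓ : 2000 ≤ ℓ) (hlam : 1000 / (ℓ : ℝ) ≤ lam) (hlam1 : lam ≤ 1)
    (hT₁c : Real.exp (-(ℓ : ℝ) ^ 11) * Fintype.card G ≤ #T₁)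
    (hV : Real.exp (-(3 * (ℓ : ℝ) ^ 11)) * Fintype.card G ≤ #V) :
    ∃ T : Finset G, 1 ∈ T ∧ T⁻¹ = T ∧ T ⊆ T₁ ^ 2 ∧
      Real.exp (-(ℓ : ℝ) ^ 22) * Fintype.card G ≤ #T ∧
      ∀ τ ∈ T ^ 20, (#{g | lam ^ 2 / 20 < |hitDensity V D (τ * g) - hitDensity V D g|} : ℝ) ≤
        lam ^ 2 / 20 * (Real.exp (-(2 * (ℓ : ℝ))) * Fintype.card G) := by
  have hN : (0 : ℝ) < Fintype.card G := by exact_mod_cast (Fintype.card_pos : 0 < Fintype.card G)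
  have hℓ' : (2000 : ℝ) ≤ ℓ := by exact_mod_cast hℓ
  have hlam0 : 0 < lam := lt_of_lt_of_le (by positivity) hlam
  have hVne : V.Nonempty := card_pos.1 (by
    have : (0 : ℝ) < #V := lt_of_lt_of_le (by positivity) hV
    exact_mod_cast this)
  -- Twenty factors, each moving by 2·lam²/800, give lam²/20. Since lam·ℓ ≥ 1000, taking k = ℓ^5
  -- makes the tail exponent at least 5ℓ, enough to beat lam²·exp(-2ℓ).
  obtain ⟨T, h1, hinv, hsub, hcard, hap⟩ := exists_almostPeriods T₁ V D ⟨1, hT₁⟩ hVne (ℓ ^ 5)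
    (by positivity) (lam ^ 2 / 800) (by positivity) (by nlinarith)
  refine ⟨T, h1, hinv, ?_, ?_, ?_⟩
  · rwa [hT₁inv, ← pow_two] at hsub
  · have h2 : (#T₁ : ℝ) * (#V : ℝ) ^ (ℓ ^ 5) ≤ 2 * #T * (Fintype.card G : ℝ) ^ (ℓ ^ 5) := by
      exact_mod_cast hcard
    have h3 : (Real.exp (-(ℓ : ℝ) ^ 11) * Fintype.card G) *
        (Real.exp (-(3 * (ℓ : ℝ) ^ 11)) * Fintype.card G) ^ (ℓ ^ 5) ≤
        #T₁ * (#V : ℝ) ^ (ℓ ^ 5) := by gcongr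
    have h4 : Real.exp (-((ℓ : ℝ) ^ 11 + ℓ ^ 5 * (3 * (ℓ : ℝ) ^ 11))) * Fintype.card G ≤
        2 * #T := by
      have h5 := h3.trans h2
      have h6 : (0 : ℝ) < (Fintype.card G : ℝ) ^ (ℓ ^ 5) := by positivity
      refine le_of_mul_le_mul_right (le_trans (le_of_eq ?_) h5) h6
      rw [neg_add, Real.exp_add, mul_pow, ← Real.exp_nat_mul]
      have : ((ℓ ^ 5 : ℕ) : ℝ) * -(3 * (ℓ : ℝ) ^ 11) = -(ℓ ^ 5 * (3 * (ℓ : ℝ) ^ 11)) := by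
        push_cast; ring
      rw [this]
      ring
    have h7 := exp_neg_le_half_mul ((ℓ : ℝ) ^ 11 + ℓ ^ 5 * (3 * (ℓ : ℝ) ^ 11)) ((ℓ : ℝ) ^ 22) (by
      have h8 : (1 : ℝ) ≤ (ℓ : ℝ) ^ 16 := one_le_pow₀ (by linarith)
      have h9 : (ℓ : ℝ) ^ 11 ≤ (ℓ : ℝ) ^ 16 := pow_le_pow_right₀ (by linarith) (by norm_num)
      have h10 : (5 : ℝ) ≤ (ℓ : ℝ) ^ 6 := by
        have := le_self_pow₀ (show (1 : ℝ) ≤ ℓ by linarith) (show 6 ≠ 0 by norm_num)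
        linarith
      calc _ = (ℓ : ℝ) ^ 11 + 3 * (ℓ : ℝ) ^ 16 + 1 := by ring
        _ ≤ 5 * (ℓ : ℝ) ^ 16 := by linarith
        _ ≤ (ℓ : ℝ) ^ 6 * (ℓ : ℝ) ^ 16 := by gcongr
        _ = _ := by ring)
    nlinarith
  · intro τ hτ
    have h2 := almostPeriods_pow (hitDensity V D) T _ _ hap 20 τ hτ
    have h3 : ((20 : ℕ) : ℝ) * (2 * (lam ^ 2 / 800)) = lam ^ 2 / 20 := by push_cast; ring
    rw [h3] at h2
    refine h2.trans ?_
    have h4 : (1000 : ℝ) ≤ lam * ℓ := by rwa [div_le_iff₀ (by linarith)] at hlam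
    have h5 : 5 * (ℓ : ℝ) ≤ ((ℓ ^ 5 : ℕ) : ℝ) * (lam ^ 2 / 800) ^ 2 / 4 := by
      have h6 : (1000 : ℝ) ^ 4 ≤ (lam * ℓ) ^ 4 := by gcongr
      have h7 : (1000 : ℝ) ^ 4 * ℓ ≤ (lam * ℓ) ^ 4 * ℓ := by gcongr
      push_cast
      nlinarith
    have h6 : Real.exp (-(((ℓ ^ 5 : ℕ) : ℝ) * (lam ^ 2 / 800) ^ 2 / 4)) ≤
        Real.exp (-(5 * (ℓ : ℝ))) := Real.exp_le_exp.2 (by linarith)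
    have h7 : 3200 * Real.exp (-(5 * (ℓ : ℝ))) ≤ lam ^ 2 * Real.exp (-(2 * (ℓ : ℝ))) := by
      have h8 : Real.exp (-(5 * (ℓ : ℝ))) =
          Real.exp (-(2 * (ℓ : ℝ))) * (Real.exp (-ℓ) * (Real.exp (-ℓ) * Real.exp (-ℓ))) := by
        rw [← Real.exp_add, ← Real.exp_add, ← Real.exp_add]; congr 1; ring
      have h9 : Real.exp (-ℓ) ≤ lam := by
        refine le_trans ?_ hlam
        rw [Real.exp_neg, inv_le_comm₀ (Real.exp_pos _) (by positivity), inv_div]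
        have := Real.add_one_le_exp (ℓ : ℝ)
        linarith
      have h10 : 3200 * Real.exp (-ℓ) ≤ 1 := by
        rw [Real.exp_neg, ← div_eq_mul_inv, div_le_one (Real.exp_pos _)]
        have := le_exp_of_hundred_le ℓ (by linarith)
        nlinarith
      calc 3200 * Real.exp (-(5 * (ℓ : ℝ))) = Real.exp (-(2 * (ℓ : ℝ))) *
            ((3200 * Real.exp (-ℓ)) * (Real.exp (-ℓ) * Real.exp (-ℓ))) := by rw [h8]; ring
        _ ≤ Real.exp (-(2 * (ℓ : ℝ))) * (1 * (lam * lam)) := by gcongr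
        _ = _ := by ring
    push_cast at h6 ⊢
    nlinarith

/-- Either there are many solutions around `w`, or there is a density increment. -/
theorem le_card_of_cluster (A Y R T₁ : Finset G) (w : G) (lam eps : ℝ) (ℓ : ℕ)
    (hℓ : 2000 ≤ ℓ) (hlam : 1000 / (ℓ : ℝ) ≤ lam) (hlam1 : lam ≤ 1) (hℓeps : 1 / (ℓ : ℝ) ≤ eps)
    (hsq : ∀ a ∈ A, ∀ b ∈ A, a ≠ b → a ^ 2 ≠ b ^ 2)
    (hno : ¬ HasDenseCell A (101 / 100 * lam) eps (ℓ ^ 220))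
    (hT₁ : 1 ∈ T₁) (hT₁inv : T₁⁻¹ = T₁) (hRinv : R⁻¹ = R)
    (hRc : Real.exp (-(2 * (ℓ : ℝ))) * Fintype.card G ≤ #R)
    (hT₁c : Real.exp (-(ℓ : ℝ) ^ 11) * Fintype.card G ≤ #T₁)
    (hRT : (#(T₁ ^ 24 * R * T₁ ^ 24) : ℝ) ≤ (1 + 1 / 1000) * #R)
    (hYA : Y ⊆ A) (hY : Real.exp (-(3 * (ℓ : ℝ) ^ 11)) * Fintype.card G ≤ #Y)
    (hwR : 7 / 8 * lam * #R ≤ #{r ∈ R | w * r ∈ A})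
    (hRw : 7 / 8 * lam * #R ≤ #{r ∈ R | r * w ∈ A})
    (hwY : ∀ y ∈ Y, w⁻¹ * y ∈ T₁ ^ 2) (hYw : ∀ y ∈ Y, y * w⁻¹ ∈ T₁ ^ 2) :
    lam ^ 2 / 4 * #R * #Y ≤
      #((A ×ˢ A ×ˢ A).filter (fun t : G × G × G => t.1 * t.2.2 = t.2.1 ^ 2)) := by
  have hN : (0 : ℝ) < Fintype.card G := by exact_mod_cast (Fintype.card_pos : 0 < Fintype.card G)
  have hℓ' : (2000 : ℝ) ≤ ℓ := by exact_mod_cast hℓ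
  have hlam0 : 0 < lam := lt_of_lt_of_le (by positivity) hlam
  have hYne : Y.Nonempty := card_pos.1 (by
    have : (0 : ℝ) < #Y := lt_of_lt_of_le (by positivity) hY
    exact_mod_cast this)
  have hRne : R.Nonempty := card_pos.1 (by
    have : (0 : ℝ) < #R := lt_of_lt_of_le (by positivity) hRc
    exact_mod_cast this)
  set V := Y.image fun y => w⁻¹ * y ^ 2 * w⁻¹ with hV
  have hVcard : #V = #Y := by
    refine card_image_of_injOn fun y hy y' hy' h => ?_
    by_contra hne
    exact hsq y (hYA hy) y' (hYA hy') hne (mul_left_cancel (mul_right_cancel h))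
  have hVsub : V ⊆ T₁ ^ 4 := by
    intro v hv
    obtain ⟨y, hy, rfl⟩ := mem_image.1 hv
    rw [show 4 = 2 + 2 from rfl, pow_add]
    convert mul_mem_mul (hwY y hy) (hYw y hy) using 1
    simp only [pow_two, mul_assoc]
  let Z : Finset G := {d | d * w ∈ A}
  let X : Finset G := {c ∈ R | w * c ∈ A}
  obtain ⟨T₂, hT₂, hT₂inv, hT₂sub, hT₂c, hap⟩ := exists_dense_almostPeriods T₁ V Z⁻¹ hT₁ hT₁inv
    lam ℓ hℓ hlam hlam1 hT₁c (by rw [hVcard]; exact hY)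
  -- The exponent 220 arises here: `T₂` has density exp(-ℓ^22), and regularising costs a tenth
  -- power.
  obtain ⟨U, T, h1, hinv, hUinv, hUsub, -, hUc, hTc, hUT⟩ := exists_regular T₂ (ℓ ^ 22)
    (le_trans (by omega) (Nat.le_self_pow (by norm_num) ℓ)) (by push_cast; exact hT₂c)
  have hUne : U.Nonempty := card_pos.1 (by
    have : (0 : ℝ) < #U := lt_of_lt_of_le (by positivity) hUc
    exact_mod_cast this)
  have hpowle : ∀ {a b : ℕ}, a ≤ b → (ℓ : ℝ) ^ a ≤ (ℓ : ℝ) ^ b := fun hab =>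
    pow_le_pow_right₀ (by linarith) hab
  have hcell : ∀ g h, (#{u ∈ U | g * u * h ∈ A} : ℝ) ≤ 101 / 100 * lam * #U :=
    card_cell_le_of_not_hasDenseCell hno (m := ℓ ^ 22) (le_trans (by
      push_cast
      exact one_div_le_one_div_of_le (by linarith) (le_self_pow₀ (by linarith) (by norm_num)))
      hℓeps) h1 hinv hUc (by
        push_cast
        exact hpowle (by norm_num)) hTc (by
        push_cast
        rw [← pow_mul]) hUT
  rw [hT₂inv, ← pow_two, ← pow_mul] at hUsub
  have hU20 : U ⊆ T₁ ^ 20 := by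
    refine hUsub.trans ((pow_subset_pow_left hT₂sub).trans ?_)
    rw [← pow_mul]
  -- This fixes the choice of 24: `U` lies in T₂^10, hence in T₁^20, and `V` in T₁^4, so U*V*R is
  -- covered by the small thickening T₁^24*R.
  have h24 : T₁ ^ 24 = T₁ ^ 20 * T₁ ^ 4 := pow_add T₁ 20 4
  have hΩ : #(T₁ ^ 24 * R) ≤ #(T₁ ^ 24 * R * T₁ ^ 24) :=
    card_le_card_mul_right ⟨1, one_mem_pow hT₁⟩
  have hmain := le_sum_hitDensity R U V (T₁ ^ 24 * R) X Z lam (1 / 1000) hlam0 le_rfl hRne hUne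
    (card_pos.1 (by rw [hVcard]; exact hYne.card_pos)) hRinv hUinv (filter_subset _ _) hwR
    (by simpa [Z] using hRw)
    (by
      rw [h24]
      exact mul_subset_mul (mul_subset_mul hU20 hVsub) subset_rfl)
    (mul_subset_mul (hU20.trans (pow_subset_pow_right hT₁ (by norm_num))) subset_rfl)
    (le_trans (Nat.cast_le.2 hΩ) hRT)
    (fun c => by
      refine le_trans ?_ (hcell w c)
      have : #{u ∈ U | u * c ∈ X} ≤ #{u ∈ U | w * u * c ∈ A} := by
        refine card_le_card fun u hu => ?_
        obtain ⟨hu, hX⟩ := mem_filter.1 hu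
        refine mem_filter.2 ⟨hu, ?_⟩
        rw [mul_assoc]
        exact (mem_filter.1 hX).2
      exact_mod_cast this)
    (fun c v hv => by
      refine le_trans (le_of_eq ?_) (hcell c⁻¹ (v * w))
      rw [← card_filter_inv hUinv, Nat.cast_inj]
      congr 1
      refine filter_congr fun u _ => ?_
      simp only [Z, mem_inv', mem_filter, mem_univ, true_and]
      simp [mul_assoc])
    (fun τ hτ => by
      have hτ' : τ ∈ T₂ ^ 20 := by
        have := mul_subset_mul hUsub hUsub hτ
        rwa [← pow_add] at this
      refine (hap τ hτ').trans ?_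
      gcongr)
  have hsol := sum_hitDensity_le_card A X Y Z w hsq hYA hYne
    (fun c hc => (mem_filter.1 hc).2) (fun d hd => (mem_filter.1 hd).2)
  refine le_trans ?_ hsol
  gcongr

/-- One step of the density increment. -/
theorem HasDenseCell.step {A : Finset G} {lam eps : ℝ} {ℓ : ℕ} (hA : HasDenseCell A lam eps ℓ)
    (hℓ : 2000 ≤ ℓ) (heps : eps ≤ lam / 1000) (hℓeps : 1 / (ℓ : ℝ) ≤ eps)
    (hsq : ∀ a ∈ A, ∀ b ∈ A, a ≠ b → a ^ 2 ≠ b ^ 2) :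
    HasDenseCell A (101 / 100 * lam) eps (ℓ ^ 220) ∨
      Real.exp (-((ℓ ^ 220 : ℕ) : ℝ)) * (Fintype.card G : ℝ) ^ 2 ≤
        #((A ×ˢ A ×ˢ A).filter (fun t : G × G × G => t.1 * t.2.2 = t.2.1 ^ 2)) := by
  rw [or_iff_not_imp_left]
  intro hno
  have hlam1 := hA.lam_le_one
  have hN : (0 : ℝ) < Fintype.card G := by exact_mod_cast (Fintype.card_pos : 0 < Fintype.card G)
  have hℓ' : (2000 : ℝ) ≤ ℓ := by exact_mod_cast hℓ
  have hlam : 1000 / (ℓ : ℝ) ≤ lam := by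
    rw [show 1000 / (ℓ : ℝ) = 1000 * (1 / (ℓ : ℝ)) by ring]; linarith
  have hlam0 : 0 < lam := lt_of_lt_of_le (by positivity) hlam
  obtain ⟨U, T, g, h, hT, hTinv, hUc, hTc, hUT, hd⟩ := hA
  have hne : ∀ {S : Finset G} {x : ℝ}, Real.exp x * Fintype.card G ≤ #S → S.Nonempty := by
    intro S x hS
    have : (0 : ℝ) < #S := lt_of_lt_of_le (by positivity) hS
    exact card_pos.1 (by exact_mod_cast this)
  obtain ⟨Q, hQc, hQg, hQh⟩ := exists_common_refinement T hTinv g h ℓ hTc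
  obtain ⟨R, T₁, hT₁, hT₁inv, hRinv, hRsub, hT₁sub, hRc, hT₁c, hRT⟩ :=
    exists_regular Q (2 * ℓ) (by omega) (by push_cast; exact hQc)
  push_cast at hRc hT₁c hRT
  have hT₁c' : Real.exp (-(ℓ : ℝ) ^ 11) * Fintype.card G ≤ #T₁ := by
    refine le_trans ?_ hT₁c
    gcongr
    rw [mul_pow]
    calc (2 : ℝ) ^ 10 * (ℓ : ℝ) ^ 10 ≤ ℓ * (ℓ : ℝ) ^ 10 := by
          gcongr
          norm_num
          linarith
      _ = _ := by ring
  -- The second scale for `exists_cluster`: `R₂` lies in T₁^10, so it barely moves `R`, and `A` has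
  -- no increment on it either.
  obtain ⟨R₂, T₂, hT₂, hT₂inv, hR₂inv, hR₂sub, -, hR₂c, hT₂c, hR₂T⟩ :=
    exists_regular T₁ (ℓ ^ 11) (le_trans (by omega) (Nat.le_self_pow (by norm_num) ℓ))
      (by push_cast; exact hT₁c')
  rw [hT₁inv, ← pow_two, ← pow_mul] at hR₂sub
  have hpowle : ∀ {a b : ℕ}, a ≤ b → (ℓ : ℝ) ^ a ≤ (ℓ : ℝ) ^ b := fun hab =>
    pow_le_pow_right₀ (by linarith) hab
  have h2ℓ : 2 * (ℓ : ℝ) ≤ (ℓ : ℝ) ^ 11 := by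
    calc 2 * (ℓ : ℝ) ≤ (ℓ : ℝ) ^ 2 := by nlinarith
      _ ≤ _ := hpowle (by norm_num)
  have hinvle : ∀ {m : ℕ}, ℓ ≤ m → 1 / (m : ℝ) ≤ eps := fun hm =>
    le_trans (one_div_le_one_div_of_le (by linarith) (by exact_mod_cast hm)) hℓeps
  have hRA : ∀ g h, (#{r ∈ R | g * r * h ∈ A} : ℝ) ≤ 101 / 100 * lam * #R :=
    card_cell_le_of_not_hasDenseCell hno (m := 2 * ℓ) (hinvle (by omega)) hT₁ hT₁inv hRc
      (by push_cast; exact h2ℓ.trans (hpowle (by norm_num))) hT₁c'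
      (by push_cast; exact hpowle (by norm_num)) (by push_cast; exact hRT)
  have hR₂A : ∀ g h, (#{r ∈ R₂ | g * r * h ∈ A} : ℝ) ≤ 101 / 100 * lam * #R₂ :=
    card_cell_le_of_not_hasDenseCell hno (m := ℓ ^ 11)
      (hinvle (Nat.le_self_pow (by norm_num) ℓ)) hT₂ hT₂inv hR₂c
      (by push_cast; exact hpowle (by norm_num)) hT₂c
      (by push_cast; rw [← pow_mul]; exact hpowle (by norm_num)) hR₂T
  have hTmono : ∀ {a b : ℕ}, a ≤ b → T ^ a ⊆ T ^ b := fun hab => pow_subset_pow_right hT hab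
  have hQh' : ∀ x ∈ Q * Q⁻¹, h⁻¹⁻¹ * x * h⁻¹ ∈ T ^ 2 := by simpa using hQh
  have hR₂Q : R₂ ⊆ (Q * Q⁻¹) ^ 2 :=
    hR₂sub.trans ((pow_subset_pow_right hT₁ (by norm_num)).trans hT₁sub)
  have hRT' : (#(T₁ ^ 24 * R * T₁ ^ 24) : ℝ) ≤ (1 + eps) * #R := by
    refine hRT.trans ?_
    have := hinvle (m := 2 * ℓ) (by omega)
    push_cast at this
    gcongr
  obtain ⟨Y, hYA, w, -, hwR, hRw, hwY, hYw, hYc⟩ := exists_cluster A U T R T₁ R₂ g h lam eps hlam0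
    heps (hne hUc) (hne hRc) (hne hR₂c) hT₁ hT hT₁inv hRinv hR₂inv hUT hRT'
    (fun r hr => hTmono (by norm_num) (conj_mem_pow g hQg 5 r (hRsub hr)))
    (fun r hr => hTmono (a := 2 * 5) (by norm_num)
      (by simpa using conj_mem_pow h⁻¹ hQh' 5 r (hRsub hr)))
    (fun r hr => hTmono (by norm_num) (conj_mem_pow g hQg 2 r (hR₂Q hr)))
    (fun r hr => hTmono (a := 2 * 2) (by norm_num)
      (by simpa using conj_mem_pow h⁻¹ hQh' 2 r (hR₂Q hr)))
    (hR₂sub.trans (pow_subset_pow_right hT₁ (by norm_num))) hd hRA hR₂A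
  have hlamexp : Real.exp (-ℓ) ≤ lam / 2 := by
    have h1 : Real.exp (-(ℓ : ℝ)) ≤ 1 / ℓ := by
      rw [Real.exp_neg, inv_le_comm₀ (Real.exp_pos _) (by positivity), one_div, inv_inv]
      have := Real.add_one_le_exp (ℓ : ℝ)
      linarith
    linarith
  have hYc' : Real.exp (-(3 * (ℓ : ℝ) ^ 11)) * Fintype.card G ≤ #Y := by
    have h1 : Real.exp (-ℓ) * (Real.exp (-ℓ) * Fintype.card G) *
        (Real.exp (-(ℓ : ℝ) ^ 11) * Fintype.card G) ^ 2 ≤ #Y * (Fintype.card G : ℝ) ^ 2 := by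
      refine le_trans ?_ hYc
      gcongr
    have h2 : Real.exp (-(3 * (ℓ : ℝ) ^ 11)) ≤
        Real.exp (-ℓ) * Real.exp (-ℓ) * Real.exp (-(ℓ : ℝ) ^ 11) ^ 2 := by
      rw [← Real.exp_nat_mul, ← Real.exp_add, ← Real.exp_add]
      refine Real.exp_le_exp.2 ?_
      push_cast
      linarith
    have h3 : (0 : ℝ) < (Fintype.card G : ℝ) ^ 2 := by positivity
    refine le_of_mul_le_mul_right (le_trans ?_ h1) h3
    calc _ ≤ (Real.exp (-ℓ) * Real.exp (-ℓ) * Real.exp (-(ℓ : ℝ) ^ 11) ^ 2) * Fintype.card G *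
          (Fintype.card G : ℝ) ^ 2 := by gcongr
      _ = _ := by ring
  have hcount := le_card_of_cluster A Y R T₁ w lam eps ℓ hℓ hlam hlam1 hℓeps hsq hno hT₁ hT₁inv
    hRinv hRc hT₁c' (hRT'.trans (by gcongr; linarith)) hYA hYc' hwR hRw hwY hYw
  refine le_trans ?_ hcount
  have h1 : Real.exp (-((ℓ ^ 220 : ℕ) : ℝ)) ≤ Real.exp (-ℓ) ^ 2 * Real.exp (-(2 * (ℓ : ℝ))) *
      Real.exp (-(3 * (ℓ : ℝ) ^ 11)) := by
    rw [← Real.exp_nat_mul, ← Real.exp_add, ← Real.exp_add]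
    refine Real.exp_le_exp.2 ?_
    have h2 : (ℓ : ℝ) * (ℓ : ℝ) ^ 11 ≤ (ℓ : ℝ) ^ 220 := by
      rw [← pow_succ']; exact hpowle (by norm_num)
    have h3 : 2000 * (ℓ : ℝ) ^ 11 ≤ (ℓ : ℝ) * (ℓ : ℝ) ^ 11 := by gcongr
    push_cast
    nlinarith
  calc _ ≤ Real.exp (-ℓ) ^ 2 * Real.exp (-(2 * (ℓ : ℝ))) *
      Real.exp (-(3 * (ℓ : ℝ) ^ 11)) * (Fintype.card G : ℝ) ^ 2 := by gcongr
    _ = Real.exp (-ℓ) ^ 2 * (Real.exp (-(2 * (ℓ : ℝ))) * Fintype.card G) *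
      (Real.exp (-(3 * (ℓ : ℝ) ^ 11)) * Fintype.card G) := by ring
    _ ≤ (lam / 2) ^ 2 * #R * #Y := by gcongr
    _ = _ := by ring

/-! ### Iteration and choice of parameters -/

theorem hasDenseCell_univ (A : Finset G) {lam eps : ℝ} (heps : 0 ≤ eps) (ℓ : ℕ)
    (hA : lam * Fintype.card G ≤ #A) : HasDenseCell A lam eps ℓ := by
  have hexp : Real.exp (-(ℓ : ℝ)) ≤ 1 := Real.exp_le_one_iff.2 (by simp)
  have hN : (0 : ℝ) ≤ Fintype.card G := by positivity
  refine ⟨univ, univ, 1, 1, mem_univ _, by simp, ?_, ?_, ?_, ?_⟩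
  · rw [card_univ]; nlinarith
  · rw [card_univ]; nlinarith
  · have : (#((univ : Finset G) ^ 24 * univ * univ ^ 24) : ℝ) ≤ #(univ : Finset G) :=
      Nat.cast_le.2 (card_le_card (subset_univ _))
    nlinarith [(Nat.cast_nonneg #(univ : Finset G) : (0 : ℝ) ≤ _)]
  · simpa using hA

/-- The tolerance stays at α/1000 throughout: it remains below lam/1000 as lam grows, and above 1/ℓ
as ℓ grows. -/
theorem hasDenseCell_or_le_card (A : Finset G) (α : ℝ) (hα : 0 < α)
    (hA : α * Fintype.card G ≤ #A) (hsq : ∀ a ∈ A, ∀ b ∈ A, a ≠ b → a ^ 2 ≠ b ^ 2)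
    (ℓ : ℕ) (hℓ : 2000 ≤ ℓ) (hℓα : 1000 / α ≤ ℓ) (n : ℕ) :
    HasDenseCell A ((101 / 100) ^ n * α) (α / 1000) (ℓ ^ 220 ^ n) ∨
      Real.exp (-((ℓ ^ 220 ^ n : ℕ) : ℝ)) * (Fintype.card G : ℝ) ^ 2 ≤
        #((A ×ˢ A ×ˢ A).filter (fun t : G × G × G => t.1 * t.2.2 = t.2.1 ^ 2)) := by
  have hℓ0 : (0 : ℝ) < ℓ := by
    have : (2000 : ℝ) ≤ ℓ := by exact_mod_cast hℓ
    linarith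
  induction n with
  | zero =>
    left
    rw [pow_zero, one_mul]
    exact hasDenseCell_univ A (by positivity) _ hA
  | succ n ih =>
    have hpow : ℓ ^ 220 ^ (n + 1) = (ℓ ^ 220 ^ n) ^ 220 := by rw [← pow_mul, pow_succ 220 n]
    have hge : ℓ ≤ ℓ ^ 220 ^ n := Nat.le_self_pow (by positivity) ℓ
    rcases ih with h | h
    · have h1 : (1 : ℝ) ≤ (101 / 100 : ℝ) ^ n := one_le_pow₀ (by norm_num)
      have h2 := h.step (hℓ.trans hge) (by nlinarith) (by
        refine (one_div_le_one_div_of_le hℓ0 (Nat.cast_le.2 hge)).trans ?_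
        rw [div_le_iff₀ hα] at hℓα
        rw [div_le_div_iff₀ hℓ0 (by norm_num)]
        linarith) hsq
      rw [hpow, pow_succ', mul_assoc]
      exact h2
    · right
      refine le_trans ?_ h
      gcongr
      · omega
      · norm_num
      · omega

theorem exp_le_card_of_lt (A : Finset G) (α : ℝ) (hα : 0 < α)
    (hA : α * Fintype.card G ≤ #A) (hsq : ∀ a ∈ A, ∀ b ∈ A, a ≠ b → a ^ 2 ≠ b ^ 2)
    (ℓ : ℕ) (hℓ : 2000 ≤ ℓ) (hℓα : 1000 / α ≤ ℓ) (n : ℕ) (hn : 1 < (101 / 100) ^ n * α) :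
    Real.exp (-((ℓ ^ 220 ^ n : ℕ) : ℝ)) * (Fintype.card G : ℝ) ^ 2 ≤
      #((A ×ˢ A ×ˢ A).filter (fun t : G × G × G => t.1 * t.2.2 = t.2.1 ^ 2)) := by
  rcases hasDenseCell_or_le_card A α hα hA hsq ℓ hℓ hℓα n with h | h
  · exact absurd h.lam_le_one (not_le.2 hn)
  · exact h

/-- The number of steps and the growth of the parameters are bounded in terms of the density. -/
theorem exists_iteration_parameters (α : ℝ) (hα : 0 < α) (hα1 : α ≤ 3 / 4) :
    ∃ ℓ n : ℕ, 2000 ≤ ℓ ∧ 1000 / α ≤ ℓ ∧ 1 < (101 / 100) ^ n * α ∧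
      ((ℓ ^ 220 ^ n : ℕ) : ℝ) ≤ Real.exp (α ^ (-700 : ℝ)) := by
  set L := Real.log (1 / α) with hL
  have h1α : 4 / 3 ≤ 1 / α := by rw [div_le_div_iff₀ (by norm_num) hα]; linarith
  have hL0 : 0 ≤ L := Real.log_nonneg (by linarith)
  have hexpL : Real.exp L = 1 / α := Real.exp_log (by positivity)
  -- Needed to absorb additive constants: the final exponent 6n + 3 + L is at most 607L + 15, hence
  -- at most 700L. This is where α must stay away from 1.
  have hL1 : 1 / 4 ≤ L := by
    have := Real.one_sub_inv_le_log_of_pos (show (0 : ℝ) < 4 / 3 by norm_num)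
    have h2 : Real.log (4 / 3) ≤ L := Real.log_le_log (by norm_num) h1α
    norm_num at this
    linarith
  have hLα : L ≤ 1 / α := by
    have := Real.add_one_le_exp L
    linarith
  -- Since log(101/100) ≥ 1/101, this many steps push the density past 1; the extra step makes the
  -- inequality strict.
  set n := ⌈101 * L⌉₊ + 1 with hn
  have hn1 : 101 * L < n := by
    rw [hn]; push_cast
    linarith [Nat.le_ceil (101 * L)]
  have hn2 : (n : ℝ) ≤ 101 * L + 2 := by
    rw [hn]; push_cast
    linarith [(Nat.ceil_lt_add_one (show 0 ≤ 101 * L by positivity)).le]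
  set ℓ := ⌈2000 / α⌉₊ with hℓ
  have hℓ1 : 2000 / α ≤ ℓ := Nat.le_ceil _
  have hℓ2 : (ℓ : ℝ) ≤ 2001 * (1 / α) := by
    have := (Nat.ceil_lt_add_one (show 0 ≤ 2000 / α by positivity)).le
    have h3 : 2000 / α = 2000 * (1 / α) := by ring
    linarith
  have hℓ3 : (2000 : ℝ) ≤ ℓ := by
    have h3 : 2000 / α = 2000 * (1 / α) := by ring
    linarith
  have hlog : 1 / 101 ≤ Real.log (101 / 100) := by
    have := Real.one_sub_inv_le_log_of_pos (show (0 : ℝ) < 101 / 100 by norm_num)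
    norm_num at this ⊢
    exact this
  refine ⟨ℓ, n, by exact_mod_cast hℓ3, le_trans (by gcongr; norm_num) hℓ1, ?_, ?_⟩
  · have h2 : 1 / α < (101 / 100 : ℝ) ^ n := by
      rw [← hexpL, ← Real.rpow_natCast, Real.rpow_def_of_pos (by norm_num)]
      refine Real.exp_lt_exp.2 ?_
      have : (1 / 101) * (n : ℝ) ≤ Real.log (101 / 100) * n := by gcongr
      linarith
    rwa [div_lt_iff₀ hα] at h2
  · have he : (2.7 : ℝ) ≤ Real.exp 1 := by linarith [Real.exp_one_gt_d9]
    have h220 : (220 : ℝ) ≤ Real.exp 6 := by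
      calc (220 : ℝ) ≤ 2.7 ^ 6 := by norm_num
        _ ≤ Real.exp 1 ^ 6 := by gcongr
        _ = Real.exp 6 := by rw [← Real.exp_nat_mul]; norm_num
    have h2001 : (2001 : ℝ) ≤ Real.exp 8 := by
      calc (2001 : ℝ) ≤ 2.7 ^ 8 := by norm_num
        _ ≤ Real.exp 1 ^ 8 := by gcongr
        _ = Real.exp 8 := by rw [← Real.exp_nat_mul]; norm_num
    have h9 : (9 : ℝ) ≤ Real.exp 3 := by
      calc (9 : ℝ) ≤ 2.7 ^ 3 := by norm_num
        _ ≤ Real.exp 1 ^ 3 := by gcongr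
        _ = Real.exp 3 := by rw [← Real.exp_nat_mul]; norm_num
    have hℓe : (ℓ : ℝ) ≤ Real.exp (9 * Real.exp L) := by
      calc (ℓ : ℝ) ≤ 2001 * (1 / α) := hℓ2
        _ ≤ Real.exp 8 * Real.exp L := by rw [hexpL]; gcongr
        _ = Real.exp (8 + L) := by rw [Real.exp_add]
        _ ≤ _ := by
          refine Real.exp_le_exp.2 ?_
          have := Real.add_one_le_exp L
          linarith
    have hp : (220 : ℝ) ^ n ≤ Real.exp (6 * n) := by
      calc (220 : ℝ) ^ n ≤ Real.exp 6 ^ n := by gcongr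
        _ = _ := by rw [← Real.exp_nat_mul]; congr 1; ring
    have hαr : α ^ (-700 : ℝ) = Real.exp (700 * L) := by
      rw [Real.rpow_def_of_pos hα, hL, one_div, Real.log_inv]
      congr 1; ring
    rw [hαr]
    push_cast
    calc (ℓ : ℝ) ^ 220 ^ n ≤ Real.exp (9 * Real.exp L) ^ 220 ^ n := by gcongr
      _ = Real.exp ((220 : ℝ) ^ n * (9 * Real.exp L)) := by
        rw [← Real.exp_nat_mul]; push_cast; rfl
      _ ≤ _ := by
        refine Real.exp_le_exp.2 ?_
        calc (220 : ℝ) ^ n * (9 * Real.exp L) ≤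
            Real.exp (6 * n) * (Real.exp 3 * Real.exp L) := by gcongr
          _ = Real.exp (6 * n + (3 + L)) := by rw [Real.exp_add, Real.exp_add]
          _ ≤ _ := Real.exp_le_exp.2 (by linarith)

/-! ### Sets of density above 3/4 -/

/-- For fixed x the map y ↦ x⁻¹y² is injective on `A`, so at most |G| - |A| of its values miss `A`.
-/
theorem card_mul_le_card (A : Finset G) (hsq : ∀ a ∈ A, ∀ b ∈ A, a ≠ b → a ^ 2 ≠ b ^ 2) :
    (#A : ℝ) * (2 * #A - Fintype.card G) ≤
      #((A ×ˢ A ×ˢ A).filter (fun t : G × G × G => t.1 * t.2.2 = t.2.1 ^ 2)) := by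
  have h1 : ∀ x ∈ A, 2 * (#A : ℝ) - Fintype.card G ≤ #{y ∈ A | x⁻¹ * y ^ 2 ∈ A} := by
    intro x _
    have h2 : #{y ∈ A | ¬ x⁻¹ * y ^ 2 ∈ A} ≤ #Aᶜ := by
      refine card_le_card_of_injOn (fun y => x⁻¹ * y ^ 2) ?_ ?_
      · intro y hy
        exact mem_coe.2 (mem_compl.2 (mem_filter.1 (mem_coe.1 hy)).2)
      · intro y hy y' hy' h
        by_contra hne
        exact hsq y (mem_filter.1 (mem_coe.1 hy)).1 y' (mem_filter.1 (mem_coe.1 hy')).1 hne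
          (mul_left_cancel h)
    have h3 := card_filter_add_card_filter_not (s := A) (fun y => x⁻¹ * y ^ 2 ∈ A)
    have h4 := card_add_card_compl A
    have h5 : 2 * #A ≤ #{y ∈ A | x⁻¹ * y ^ 2 ∈ A} + Fintype.card G := by omega
    have h6 : 2 * (#A : ℝ) ≤ #{y ∈ A | x⁻¹ * y ^ 2 ∈ A} + Fintype.card G := by exact_mod_cast h5
    linarith
  have h2 : ∑ x ∈ A, #{y ∈ A | x⁻¹ * y ^ 2 ∈ A} ≤
      #((A ×ˢ A ×ˢ A).filter (fun t : G × G × G => t.1 * t.2.2 = t.2.1 ^ 2)) := by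
    rw [← card_sigma]
    refine card_le_card_of_injOn (fun p => (p.1, p.2, p.1⁻¹ * p.2 ^ 2)) ?_ ?_
    · rintro ⟨x, y⟩ hp
      simp only [coe_sigma, Set.mem_sigma_iff, mem_coe, mem_filter] at hp
      simp only [mem_coe, mem_filter, mem_product]
      exact ⟨⟨hp.1, hp.2.1, hp.2.2⟩, by simp⟩
    · rintro ⟨x, y⟩ _ ⟨x', y'⟩ _ h
      simp only [Prod.mk.injEq] at h
      obtain ⟨rfl, rfl, -⟩ := h
      rfl
  calc (#A : ℝ) * (2 * #A - Fintype.card G) = ∑ _x ∈ A, (2 * (#A : ℝ) - Fintype.card G) := by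
        rw [sum_const, nsmul_eq_mul]
    _ ≤ ∑ x ∈ A, (#{y ∈ A | x⁻¹ * y ^ 2 ∈ A} : ℝ) := sum_le_sum h1
    _ ≤ _ := by exact_mod_cast h2

end

end DistinctSquares

/-- The constant `C`, playing the role of the exponent `O(1)`, is absolute: it is chosen before the
group, the set and the density. The set is nonempty, i.e. its density `α` is positive. -/
theorem theorem1p5 :
    ∃ C : ℝ, 0 < C ∧
      ∀ (G : Type*) [Group G] [Fintype G] [DecidableEq G] (A : Finset G) (α : ℝ),
        A.Nonempty →
        (A.card : ℝ) = α * (Fintype.card G : ℝ) →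
        (∀ a ∈ A, ∀ b ∈ A, a ≠ b → a ^ 2 ≠ b ^ 2) →
        Real.exp (-Real.exp (α ^ (-C))) * (Fintype.card G : ℝ) ^ 2 ≤
          (((A ×ˢ A ×ˢ A).filter
            (fun t : G × G × G => t.1 * t.2.2 = t.2.1 ^ 2)).card : ℝ) := by
  refine ⟨700, by norm_num, fun G _ _ _ A α hA hcard hsq => ?_⟩
  have hN : (0 : ℝ) < Fintype.card G := by exact_mod_cast (Fintype.card_pos : 0 < Fintype.card G)
  have hA0 : (0 : ℝ) < A.card := by exact_mod_cast hA.card_pos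
  have hα : 0 < α := by
    rw [hcard] at hA0
    exact pos_of_mul_pos_left hA0 hN.le
  -- Above 3/4 the direct count already gives α(2α - 1) ≥ 3/8 of |G|².
  rcases le_or_gt α (3 / 4) with h | h
  · obtain ⟨ℓ, n, hℓ, hℓα, hn, hbound⟩ := DistinctSquares.exists_iteration_parameters α hα h
    refine le_trans ?_ (DistinctSquares.exp_le_card_of_lt A α hα hcard.ge hsq ℓ hℓ hℓα n hn)
    gcongr
  · refine le_trans ?_ (DistinctSquares.card_mul_le_card A hsq)
    have hα1 : α ≤ 1 := by
      have h1 : (A.card : ℝ) ≤ Fintype.card G := by exact_mod_cast Finset.card_le_univ A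
      rw [hcard] at h1
      exact le_of_mul_le_mul_right (by linarith) hN
    have h1 : 1 ≤ α ^ (-700 : ℝ) := Real.one_le_rpow_of_pos_of_le_one_of_nonpos hα hα1 (by norm_num)
    have h2 : 2 ≤ Real.exp (α ^ (-700 : ℝ)) := by linarith [Real.add_one_le_exp (α ^ (-700 : ℝ))]
    have h3 : Real.exp (-Real.exp (α ^ (-700 : ℝ))) ≤ 1 / 3 := by
      rw [Real.exp_neg, inv_le_comm₀ (Real.exp_pos _) (by norm_num)]
      linarith [Real.add_one_le_exp (Real.exp (α ^ (-700 : ℝ)))]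
    rw [hcard]
    have h4 : (3 : ℝ) / 8 ≤ α * (2 * α - 1) := by nlinarith
    calc _ ≤ 3 / 8 * (Fintype.card G : ℝ) ^ 2 := by gcongr; linarith
      _ ≤ α * (2 * α - 1) * (Fintype.card G : ℝ) ^ 2 := by gcongr
      _ = _ := by ring
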